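/- For $q\le N$ let $\langle x,y\rangle_q=-\sum_{i=1}^{q}x_iy_i+\sum_{i=q+1}^{N}x_iy_i$ on $\mathbb{R}^N$, let $\mathbb{E}^N_q=(\mathbb{R}^N,\langle\cdot,\cdot\rangle_q)$, and put $$\mathbb{M}^n_p(0)=\mathbb{E}^n_p,\qquad \mathbb{M}^n_p(1)=\{x\in\mathbb{E}^{n+1}_p:\langle x,x\rangle_p=1\},\qquad \mathbb{M}^n_p(-1)=\{x\in\mathbb{E}^{n+1}_{p+1}:\langle x,x\rangle_{p+1}=-1\},$$ with the induced pseudo-Riemannian metrics (dimension $n$, index $p$). Let $\mathcal{M}(\mathbb{M}^m_s(\varepsilon),\mathbb{M}^n_p(\varepsilon))$ be the moduli space of isometric immersions: the quotient of the set of all $C^\infty$ maps $\phi:\mathbb{M}^m_s(\varepsilon)\to\mathbb{M}^n_p(\varepsilon)$ that pull the metric of the target back to that of the source, with the compact-open $C^\infty$ topology, by the action $\phi\mapsto\Psi\circ\phi$ of the isometries $\Psi$ of $\mathbb{M}^n_p(\varepsilon)$. Maps in the same orbit are called congruent. Let $\varepsilon\in\{0,1,-1\}$, $m\ge 1$, $0\le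 s\le m$, $n\ge m+2$, $p\ge s+1$ and $n-p\ge m-s+1$ (so that $\mathbb{M}^{m+2}_{s+1}(\varepsilon)\subset\mathbb{M}^n_p(\varepsilon)$). Then $\mathcal{M}(\mathbb{M}^m_s(\varepsilon),\mathbb{M}^n_p(\varepsilon))$ is not Hausdorff. More precisely, put $s'=s$ if $\varepsilon\in\{0,1\}$ and $s'=s+1$ if $\varepsilon=-1$. For $a\in\mathbb{R}$ let $$\psi_a(x)=(b,x_1,\dots,x_{s'},0,\dots,0,x_{s'+1},x_{s'+2},\dots,b),\qquad b=a\ \ (\varepsilon=\pm1),\qquad b=a\langle x,x\rangle_s\ \ (\varepsilon=0),$$ where the number of zeros is $n-m-2$. Then every $\psi_a$ is an isometric immersion $\mathbb{M}^m_s(\varepsilon)\to\mathbb{M}^n_p(\varepsilon)$; $\psi_a$ is congruent to $\psi_1$ for every $a\ne0$; $\psi_a\to\psi_0$ as $a\to0$ in the compact-open $C^\infty$ topology; $\psi_0$ is totally geodesic; and $\psi_0$ is not congruent to $\psi_1$. -/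

import Mathlib

open Set Filter
open scoped Manifold ContDiff Topology

noncomputable section

namespace SpaceFormModuli

/-! ### Isometric immersions, the compact-open smooth topology, and moduli spaces

`M` and `M'` are smooth manifolds without boundary, modelled on the normed spaces `E` and `E'`. -/

/-- A field of bilinear forms on the tangent spaces of `M` (for instance a pseudo-Riemannian
metric). -/
abbrev MetricField (E : Type*) [NormedAddCommGroup E] [NormedSpace ℝ E]
    (M : Type*) [TopologicalSpace M] [ChartedSpace E M] : Type _ :=
  ∀ x : M, LinearMap.BilinForm ℝ (TangentSpace 𝓘(ℝ, E) x)

/-- `f^* g' = g`. -/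
def IsIsometric {E : Type*} [NormedAddCommGroup E] [NormedSpace ℝ E]
    {M : Type*} [TopologicalSpace M] [ChartedSpace E M]
    {E' : Type*} [NormedAddCommGroup E'] [NormedSpace ℝ E']
    {M' : Type*} [TopologicalSpace M'] [ChartedSpace E' M']
    (g : MetricField E M) (g' : MetricField E' M') (f : M → M') : Prop :=
  ∀ (x : M) (v w : TangentSpace 𝓘(ℝ, E) x),
    g' (f x) (mfderiv 𝓘(ℝ, E) 𝓘(ℝ, E') f x v) (mfderiv 𝓘(ℝ, E) 𝓘(ℝ, E') f x w) = g x v w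

/-- Given charts `φ` of `M` and `χ` of `M'`, the smooth maps `h` that send `K` into the domain of
`χ` and whose local representative `χ ∘ h ∘ φ⁻¹` is `δ`-close to that of `f` on `φ(K)`, together
with all derivatives of order at most `r`. -/
def weakNhd {E : Type*} [NormedAddCommGroup E] [NormedSpace ℝ E]
    {M : Type*} [TopologicalSpace M] [ChartedSpace E M]
    {E' : Type*} [NormedAddCommGroup E'] [NormedSpace ℝ E']
    {M' : Type*} [TopologicalSpace M'] [ChartedSpace E' M']
    (f : C^∞⟮𝓘(ℝ, E), M; 𝓘(ℝ, E'), M'⟯)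
    (φ : OpenPartialHomeomorph M E) (χ : OpenPartialHomeomorph M' E')
    (K : Set M) (r : ℕ) (δ : ℝ) : Set C^∞⟮𝓘(ℝ, E), M; 𝓘(ℝ, E'), M'⟯ :=
  {h | MapsTo h K χ.source ∧ ∀ x ∈ K, ∀ k ≤ r,
    ‖iteratedFDeriv ℝ k (χ ∘ h ∘ φ.symm) (φ x)
      - iteratedFDeriv ℝ k (χ ∘ f ∘ φ.symm) (φ x)‖ < δ}

/-- The compact-open `C^∞` topology (weak Whitney topology) on the set of smooth maps: it is
generated by the sets `weakNhd f φ χ K r δ` with `φ`, `χ` smooth charts, `K` a compact subset of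
the domain of `φ` that `f` maps into the domain of `χ`, `r` finite and `δ > 0`. -/
instance compactOpenSmoothTopology {E : Type*} [NormedAddCommGroup E] [NormedSpace ℝ E]
    {M : Type*} [TopologicalSpace M] [ChartedSpace E M]
    {E' : Type*} [NormedAddCommGroup E'] [NormedSpace ℝ E']
    {M' : Type*} [TopologicalSpace M'] [ChartedSpace E' M'] :
    TopologicalSpace C^∞⟮𝓘(ℝ, E), M; 𝓘(ℝ, E'), M'⟯ :=
  TopologicalSpace.generateFrom
    {S | ∃ (f : C^∞⟮𝓘(ℝ, E), M; 𝓘(ℝ, E'), M'⟯)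
      (φ : OpenPartialHomeomorph M E) (χ : OpenPartialHomeomorph M' E')
      (K : Set M) (r : ℕ) (δ : ℝ),
      φ ∈ IsManifold.maximalAtlas 𝓘(ℝ, E) ∞ M ∧ χ ∈ IsManifold.maximalAtlas 𝓘(ℝ, E') ∞ M' ∧
      IsCompact K ∧ K ⊆ φ.source ∧ MapsTo f K χ.source ∧ 0 < δ ∧ S = weakNhd f φ χ K r δ}

/-- The space `{φ ∈ C^∞(M, M') | φ^* g' = g}` with the compact-open `C^∞` topology. (If `g` is
nondegenerate, such a map is an immersion.) -/
abbrev IsometricImmersion {E : Type*} [NormedAddCommGroup E] [NormedSpace ℝ E]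
    {M : Type*} [TopologicalSpace M] [ChartedSpace E M]
    {E' : Type*} [NormedAddCommGroup E'] [NormedSpace ℝ E']
    {M' : Type*} [TopologicalSpace M'] [ChartedSpace E' M']
    (g : MetricField E M) (g' : MetricField E' M') : Type _ :=
  {φ : C^∞⟮𝓘(ℝ, E), M; 𝓘(ℝ, E'), M'⟯ // IsIsometric g g' φ}

/-- `φ₂ = Ψ ∘ φ₁` for some isometry `Ψ` of `(M', g')`, that is, a diffeomorphism with
`Ψ^* g' = g'`. -/
def Congruent {E : Type*} [NormedAddCommGroup E] [NormedSpace ℝ E]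
    {M : Type*} [TopologicalSpace M] [ChartedSpace E M]
    {E' : Type*} [NormedAddCommGroup E'] [NormedSpace ℝ E']
    {M' : Type*} [TopologicalSpace M'] [ChartedSpace E' M']
    {g : MetricField E M} {g' : MetricField E' M'} (φ₁ φ₂ : IsometricImmersion g g') : Prop :=
  ∃ Ψ : M' ≃ₘ⟮𝓘(ℝ, E'), 𝓘(ℝ, E')⟯ M', IsIsometric g' g' Ψ ∧ ∀ x : M, φ₂.1 x = Ψ (φ₁.1 x)

lemma IsIsometric.trans_diffeo {E' : Type*} [NormedAddCommGroup E'] [NormedSpace ℝ E']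
    {M' : Type*} [TopologicalSpace M'] [ChartedSpace E' M'] {g' : MetricField E' M'}
    {Ψ Φ : M' ≃ₘ⟮𝓘(ℝ, E'), 𝓘(ℝ, E')⟯ M'} (hΨ : IsIsometric g' g' Ψ) (hΦ : IsIsometric g' g' Φ) :
    IsIsometric g' g' (Ψ.trans Φ) := by
  intro x v w
  have h : mfderiv 𝓘(ℝ, E') 𝓘(ℝ, E') (Φ ∘ Ψ) x
      = (mfderiv 𝓘(ℝ, E') 𝓘(ℝ, E') Φ (Ψ x)).comp (mfderiv 𝓘(ℝ, E') 𝓘(ℝ, E') Ψ x) :=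
    mfderiv_comp x (Φ.mdifferentiable (by simp) _) (Ψ.mdifferentiable (by simp) _)
  rw [Diffeomorph.coe_trans, h]
  exact (hΦ (Ψ x) _ _).trans (hΨ x v w)

lemma IsIsometric.symm_diffeo {E' : Type*} [NormedAddCommGroup E'] [NormedSpace ℝ E']
    {M' : Type*} [TopologicalSpace M'] [ChartedSpace E' M'] {g' : MetricField E' M'}
    {Ψ : M' ≃ₘ⟮𝓘(ℝ, E'), 𝓘(ℝ, E')⟯ M'} (hΨ : IsIsometric g' g' Ψ) :
    IsIsometric g' g' Ψ.symm := by
  intro y v w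
  have h : mfderiv 𝓘(ℝ, E') 𝓘(ℝ, E') (Ψ ∘ Ψ.symm) y
      = (mfderiv 𝓘(ℝ, E') 𝓘(ℝ, E') Ψ (Ψ.symm y)).comp
        (mfderiv 𝓘(ℝ, E') 𝓘(ℝ, E') Ψ.symm y) :=
    mfderiv_comp y (Ψ.mdifferentiable (by simp) _) (Ψ.symm.mdifferentiable (by simp) _)
  have h' : (Ψ ∘ Ψ.symm : M' → M') = id := by
    funext z
    simp
  rw [h', mfderiv_id] at h
  have key : ∀ u : TangentSpace 𝓘(ℝ, E') y, mfderiv 𝓘(ℝ, E') 𝓘(ℝ, E') Ψ (Ψ.symm y)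
      (mfderiv 𝓘(ℝ, E') 𝓘(ℝ, E') Ψ.symm y u) = (u : E') :=
    fun u => (DFunLike.congr_fun h u).symm
  have h2 := hΨ (Ψ.symm y) (mfderiv 𝓘(ℝ, E') 𝓘(ℝ, E') Ψ.symm y v)
    (mfderiv 𝓘(ℝ, E') 𝓘(ℝ, E') Ψ.symm y w)
  rw [← h2, key, key, Diffeomorph.apply_symm_apply]

/-- Congruence is the orbit relation of the action of the isometry group of `(M', g')`. -/
def congruenceSetoid {E : Type*} [NormedAddCommGroup E] [NormedSpace ℝ E]
    {M : Type*} [TopologicalSpace M] [ChartedSpace E M]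
    {E' : Type*} [NormedAddCommGroup E'] [NormedSpace ℝ E']
    {M' : Type*} [TopologicalSpace M'] [ChartedSpace E' M']
    (g : MetricField E M) (g' : MetricField E' M') : Setoid (IsometricImmersion g g') where
  r := Congruent
  iseqv :=
    { refl := fun φ => ⟨Diffeomorph.refl _ _ _, fun x v w => by
        rw [Diffeomorph.coe_refl, mfderiv_id]; rfl, fun x => rfl⟩
      symm := by
        rintro φ₁ φ₂ ⟨Ψ, hΨ, h⟩
        exact ⟨Ψ.symm, hΨ.symm_diffeo, fun x => by rw [h, Diffeomorph.symm_apply_apply]⟩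
      trans := by
        rintro φ₁ φ₂ φ₃ ⟨Ψ, hΨ, h⟩ ⟨Φ, hΦ, h'⟩
        exact ⟨Ψ.trans Φ, hΨ.trans_diffeo hΦ, fun x => by
          rw [h', h, Diffeomorph.coe_trans, Function.comp_apply]⟩ }

/-- The moduli space of isometric immersions `(M, g) → (M', g')`: the quotient by the isometry
group of `(M', g')`, with the quotient topology. -/
abbrev ModuliSpace {E : Type*} [NormedAddCommGroup E] [NormedSpace ℝ E]
    {M : Type*} [TopologicalSpace M] [ChartedSpace E M]
    {E' : Type*} [NormedAddCommGroup E'] [NormedSpace ℝ E']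
    {M' : Type*} [TopologicalSpace M'] [ChartedSpace E' M']
    (g : MetricField E M) (g' : MetricField E' M') : Type _ :=
  Quotient (congruenceSetoid g g')

/-! ### Pseudo-Euclidean spaces and quadrics

`ℝ^N` is `Fin N → ℝ`; only its topology and its smooth structure are used. -/

/-- The signs `-1, …, -1, 1, …, 1` with `q` entries `-1`. -/
def eta (q : ℕ) {N : ℕ} (i : Fin N) : ℝ := if (i : ℕ) < q then -1 else 1

lemma eta_mul_self (q : ℕ) {N : ℕ} (i : Fin N) : eta q i * eta q i = 1 := by
  unfold eta; split_ifs <;> norm_num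

/-- The scalar product `⟨x, y⟩_q = -∑_{i < q} x_i y_i + ∑_{i ≥ q} x_i y_i` on `ℝ^N`. -/
def pseudoInner (q N : ℕ) : LinearMap.BilinForm ℝ (Fin N → ℝ) :=
  LinearMap.mk₂ ℝ (fun x y => ∑ i, eta q i * (x i * y i))
    (fun x x' y => by
      rw [← Finset.sum_add_distrib]
      exact Finset.sum_congr rfl fun i _ => by simp only [Pi.add_apply]; ring)
    (fun c x y => by
      rw [smul_eq_mul, Finset.mul_sum]
      exact Finset.sum_congr rfl fun i _ => by simp only [Pi.smul_apply, smul_eq_mul]; ring)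
    (fun x y y' => by
      rw [← Finset.sum_add_distrib]
      exact Finset.sum_congr rfl fun i _ => by simp only [Pi.add_apply]; ring)
    (fun c x y => by
      rw [smul_eq_mul, Finset.mul_sum]
      exact Finset.sum_congr rfl fun i _ => by simp only [Pi.smul_apply, smul_eq_mul]; ring)

lemma pseudoInner_apply (q N : ℕ) (x y : Fin N → ℝ) :
    pseudoInner q N x y = ∑ i, eta q i * (x i * y i) := rfl

/-- The quadric `{x ∈ ℝ^{n+1} | ⟨x, x⟩_q = c}`. -/
abbrev Quadric (n q : ℕ) (c : ℝ) : Type := {x : Fin (n + 1) → ℝ // pseudoInner q (n + 1) x x = c}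

/-- The value of `x_i ^ 2` on the quadric as a function of the other coordinates. -/
def graphRadicand (n q : ℕ) (c : ℝ) (i : Fin (n + 1)) (y : Fin n → ℝ) : ℝ :=
  eta q i * (c - ∑ j, eta q (i.succAbove j) * (y j * y j))

lemma contDiff_graphRadicand (n q : ℕ) (c : ℝ) (i : Fin (n + 1)) :
    ContDiff ℝ ∞ (graphRadicand n q c i) := by
  unfold graphRadicand
  fun_prop

lemma pseudoInner_insertNth {n q : ℕ} {c : ℝ} {i : Fin (n + 1)} {t : ℝ} {y : Fin n → ℝ}
    (h : t * t = graphRadicand n q c i y) :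
    pseudoInner q (n + 1) (i.insertNth t y : Fin (n + 1) → ℝ)
      (i.insertNth t y : Fin (n + 1) → ℝ) = c := by
  rw [pseudoInner_apply, Fin.sum_univ_succAbove _ i]
  simp only [Fin.insertNth_apply_same, Fin.insertNth_apply_succAbove]
  rw [h, graphRadicand, ← mul_assoc, eta_mul_self]
  ring

lemma graphRadicand_eq {n q : ℕ} {c : ℝ} (x : Quadric n q c) (i : Fin (n + 1)) :
    graphRadicand n q c i (fun j => x.1 (i.succAbove j)) = x.1 i * x.1 i := by
  have h := x.2
  rw [pseudoInner_apply, Fin.sum_univ_succAbove _ i] at h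
  have h' : c - ∑ j, eta q (i.succAbove j) * (x.1 (i.succAbove j) * x.1 (i.succAbove j))
      = eta q i * (x.1 i * x.1 i) := by linarith
  rw [graphRadicand, h', ← mul_assoc, eta_mul_self, one_mul]

lemma sign_mul_sqrt_mul_self (a : ℝ) (ha : a ≠ 0) {r : ℝ} (hr : 0 < r) :
    (Real.sign a * √r) * (Real.sign a * √r) = r := by
  have h1 : Real.sign a * Real.sign a = 1 := by
    rcases lt_or_gt_of_ne ha with h | h
    · rw [Real.sign_of_neg h]; norm_num
    · rw [Real.sign_of_pos h]; norm_num
  have h2 := Real.mul_self_sqrt hr.le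
  calc (Real.sign a * √r) * (Real.sign a * √r)
      = (Real.sign a * Real.sign a) * (√r * √r) := by ring
    _ = r := by rw [h1, h2, one_mul]

open Classical in
/-- The inverse of the graph chart: solve `⟨x, x⟩_q = c` for `x_i`, with the sign of `x_i` that of
the base point (outside the domain the value is the base point). -/
def graphInv {n q : ℕ} {c : ℝ} (i : Fin (n + 1)) (b : Quadric n q c) (hb : b.1 i ≠ 0)
    (y : Fin n → ℝ) : Quadric n q c :=
  if h : 0 < graphRadicand n q c i y then
    ⟨i.insertNth (Real.sign (b.1 i) * √(graphRadicand n q c i y)) y,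
      pseudoInner_insertNth (sign_mul_sqrt_mul_self _ hb h)⟩
  else b

lemma graphInv_val {n q : ℕ} {c : ℝ} (i : Fin (n + 1)) (b : Quadric n q c) (hb : b.1 i ≠ 0)
    {y : Fin n → ℝ} (h : 0 < graphRadicand n q c i y) :
    (graphInv i b hb y).1
      = i.insertNth (Real.sign (b.1 i) * √(graphRadicand n q c i y)) y := by
  rw [graphInv, dif_pos h]

lemma contDiffOn_graph {n q : ℕ} {c : ℝ} (i : Fin (n + 1)) (b : ℝ) :
    ContDiffOn ℝ ∞ (fun y : Fin n → ℝ =>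
      (i.insertNth (Real.sign b * √(graphRadicand n q c i y)) y : Fin (n + 1) → ℝ))
      {y | 0 < graphRadicand n q c i y} := by
  rw [contDiffOn_pi]
  intro k
  rcases Fin.eq_self_or_eq_succAbove i k with rfl | ⟨j, rfl⟩
  · simp only [Fin.insertNth_apply_same]
    exact contDiffOn_const.mul
      (((contDiff_graphRadicand n q c k).contDiffOn).sqrt fun y hy => ne_of_gt hy)
  · simp only [Fin.insertNth_apply_succAbove]
    fun_prop

/-- The chart of the quadric around `b` that forgets the coordinate `x_i`, where `b_i ≠ 0`; its
domain is the set of points whose `i`-th coordinate has the sign of `b_i`. -/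
def graphChart {n q : ℕ} {c : ℝ} (i : Fin (n + 1)) (b : Quadric n q c) (hb : b.1 i ≠ 0) :
    OpenPartialHomeomorph (Quadric n q c) (Fin n → ℝ) where
  toFun x := fun j => x.1 (i.succAbove j)
  invFun := graphInv i b hb
  source := {x | 0 < b.1 i * x.1 i}
  target := {y | 0 < graphRadicand n q c i y}
  map_source' x hx := by
    have : x.1 i ≠ 0 := right_ne_zero_of_mul (ne_of_gt hx)
    rw [mem_ofPred_eq, graphRadicand_eq]
    exact mul_self_pos.2 this
  map_target' y hy := by
    rw [mem_ofPred_eq] at hy ⊢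
    rw [graphInv_val i b hb hy, Fin.insertNth_apply_same, ← mul_assoc]
    refine mul_pos ?_ (Real.sqrt_pos.2 hy)
    rcases lt_or_gt_of_ne hb with h | h
    · rw [Real.sign_of_neg h]; linarith
    · rw [Real.sign_of_pos h]; linarith
  left_inv' x hx := by
    have hx' : 0 < b.1 i * x.1 i := hx
    have hx0 : x.1 i ≠ 0 := right_ne_zero_of_mul (ne_of_gt hx')
    have hr : 0 < graphRadicand n q c i (fun j => x.1 (i.succAbove j)) := by
      rw [graphRadicand_eq]; exact mul_self_pos.2 hx0
    apply Subtype.ext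
    rw [graphInv_val i b hb hr, graphRadicand_eq, Real.sqrt_mul_self_eq_abs]
    have : Real.sign (b.1 i) * |x.1 i| = x.1 i := by
      rcases lt_or_gt_of_ne hb with h | h
      · have : x.1 i < 0 := by
          by_contra hh
          exact absurd hx' (not_lt.2 (mul_nonpos_of_nonpos_of_nonneg h.le (not_lt.1 hh)))
        rw [Real.sign_of_neg h, abs_of_neg this]; ring
      · have : 0 < x.1 i := (mul_pos_iff_of_pos_left h).1 hx'
        rw [Real.sign_of_pos h, abs_of_pos this]; ring
    rw [this]
    exact Fin.insertNth_self_removeNth i x.1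
  right_inv' y hy := by
    funext j
    rw [graphInv_val i b hb hy, Fin.insertNth_apply_succAbove]
  open_source :=
    isOpen_lt continuous_const
      (continuous_const.mul ((continuous_apply i).comp continuous_subtype_val))
  open_target := isOpen_lt continuous_const (contDiff_graphRadicand n q c i).continuous
  continuousOn_toFun := Continuous.continuousOn
    (continuous_pi fun j => (continuous_apply _).comp continuous_subtype_val)
  continuousOn_invFun := by
    refine Topology.IsInducing.subtypeVal.continuousOn_iff.2 ?_
    exact (contDiffOn_graph i (b.1 i)).continuousOn.congr fun y hy => graphInv_val i b hb hy

lemma Quadric.exists_ne_zero {n q : ℕ} {c : ℝ} (hc : c ≠ 0) (x : Quadric n q c) :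
    ∃ i, x.1 i ≠ 0 := by
  by_contra! h
  have h2 := x.2
  rw [pseudoInner_apply] at h2
  exact hc (by rw [← h2]; simp [h])

/-- The quadric `⟨x, x⟩_q = c` with `c ≠ 0` as an `n`-dimensional manifold. -/
@[reducible]
def quadricChartedSpace (n q : ℕ) (c : ℝ) (hc : c ≠ 0) :
    ChartedSpace (Fin n → ℝ) (Quadric n q c) where
  atlas := {e | ∃ i b hb, e = graphChart i b hb}
  chartAt x := graphChart (Quadric.exists_ne_zero hc x).choose x (Quadric.exists_ne_zero hc x).choose_spec
  mem_chart_source x := mul_self_pos.2 (Quadric.exists_ne_zero hc x).choose_spec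
  chart_mem_atlas _ := ⟨_, _, _, rfl⟩

lemma quadric_isManifold (n q : ℕ) (c : ℝ) (hc : c ≠ 0) :
    letI := quadricChartedSpace n q c hc
    IsManifold 𝓘(ℝ, Fin n → ℝ) ∞ (Quadric n q c) := by
  let _ := quadricChartedSpace n q c hc
  refine isManifold_of_contDiffOn _ _ _ ?_
  rintro _ _ ⟨i, b, hb, rfl⟩ ⟨i', b', hb', rfl⟩
  have h : ContDiffOn ℝ ∞ (fun (y : Fin n → ℝ) (j : Fin n) =>
      (i.insertNth (Real.sign (b.1 i) * √(graphRadicand n q c i y)) y : Fin (n + 1) → ℝ)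
        (i'.succAbove j)) {y | 0 < graphRadicand n q c i y} :=
    contDiffOn_pi.2 fun j => contDiffOn_pi.1 (contDiffOn_graph i (b.1 i)) _
  have hsub : ∀ y ∈ 𝓘(ℝ, Fin n → ℝ).symm ⁻¹'
      ((graphChart i b hb).symm ≫ₕ graphChart i' b' hb').source ∩ range 𝓘(ℝ, Fin n → ℝ),
      0 < graphRadicand n q c i y := fun y hy => hy.1.1
  refine (h.mono hsub).congr fun y hy => ?_
  funext j
  exact congrFun (graphInv_val i b hb (hsub y hy)) _

/-- The inclusion of the quadric is smooth. -/
lemma quadric_contMDiff_val (n q : ℕ) (c : ℝ) (hc : c ≠ 0) :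
    letI := quadricChartedSpace n q c hc
    ContMDiff 𝓘(ℝ, Fin n → ℝ) 𝓘(ℝ, Fin (n + 1) → ℝ) ∞
      (Subtype.val : Quadric n q c → (Fin (n + 1) → ℝ)) := by
  let _ := quadricChartedSpace n q c hc
  intro x
  rw [contMDiffAt_iff]
  refine ⟨continuous_subtype_val.continuousAt, ?_⟩
  have hi := (Quadric.exists_ne_zero hc x).choose_spec
  have hpos : 0 < graphRadicand n q c (Quadric.exists_ne_zero hc x).choose
      (fun j => x.1 ((Quadric.exists_ne_zero hc x).choose.succAbove j)) := by
    rw [graphRadicand_eq]; exact mul_self_pos.2 hi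
  have hopen : IsOpen {y : Fin n → ℝ | 0 < graphRadicand n q c (Quadric.exists_ne_zero hc x).choose y} :=
    isOpen_lt continuous_const (contDiff_graphRadicand n q c _).continuous
  refine ContDiffAt.contDiffWithinAt ?_
  refine ((contDiffOn_graph (Quadric.exists_ne_zero hc x).choose
    (x.1 (Quadric.exists_ne_zero hc x).choose)).contDiffAt (hopen.mem_nhds hpos)).congr_of_eventuallyEq ?_
  filter_upwards [hopen.mem_nhds hpos] with y hy
  exact graphInv_val _ x hi hy

/-! ### The space forms `𝕄^n_p(ε)` -/

/-- The dimension of the pseudo-Euclidean space containing `𝕄^n_p(ε)`. -/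
def ambDim : SignType → ℕ → ℕ
  | 0, n => n
  | 1, n => n + 1
  | -1, n => n + 1

/-- The index of the pseudo-Euclidean space containing `𝕄^n_p(ε)`. -/
def ambIndex : SignType → ℕ → ℕ
  | 0, p => p
  | 1, p => p
  | -1, p => p + 1

/-- `𝕄^n_p(0) = 𝔼^n_p = ℝ^n`, the pseudo-sphere `𝕄^n_p(1) = {x ∈ ℝ^{n+1} | ⟨x, x⟩_p = 1}` and the
pseudo-hyperbolic space `𝕄^n_p(-1) = {x ∈ ℝ^{n+1} | ⟨x, x⟩_{p+1} = -1}`. -/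
def SpaceForm : SignType → ℕ → ℕ → Type
  | 0, n, _ => Fin n → ℝ
  | 1, n, p => Quadric n p 1
  | -1, n, p => Quadric n (p + 1) (-1)

instance : (ε : SignType) → (n p : ℕ) → TopologicalSpace (SpaceForm ε n p)
  | 0, n, _ => inferInstanceAs (TopologicalSpace (Fin n → ℝ))
  | 1, n, p => inferInstanceAs (TopologicalSpace (Quadric n p 1))
  | -1, n, p => inferInstanceAs (TopologicalSpace (Quadric n (p + 1) (-1)))

instance : (ε : SignType) → (n p : ℕ) → ChartedSpace (Fin n → ℝ) (SpaceForm ε n p)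
  | 0, n, _ => inferInstanceAs (ChartedSpace (Fin n → ℝ) (Fin n → ℝ))
  | 1, n, p => quadricChartedSpace n p 1 one_ne_zero
  | -1, n, p => quadricChartedSpace n (p + 1) (-1) (neg_ne_zero.2 one_ne_zero)

instance : (ε : SignType) → (n p : ℕ) → IsManifold 𝓘(ℝ, Fin n → ℝ) ∞ (SpaceForm ε n p)
  | 0, n, _ => inferInstanceAs (IsManifold 𝓘(ℝ, Fin n → ℝ) ∞ (Fin n → ℝ))
  | 1, n, p => quadric_isManifold n p 1 one_ne_zero
  | -1, n, p => quadric_isManifold n (p + 1) (-1) (neg_ne_zero.2 one_ne_zero)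

/-- The inclusion of `𝕄^n_p(ε)` into its pseudo-Euclidean space. -/
def incl : (ε : SignType) → (n p : ℕ) → SpaceForm ε n p → (Fin (ambDim ε n) → ℝ)
  | 0, _, _ => fun x => x
  | 1, _, _ => Subtype.val
  | -1, _, _ => Subtype.val

lemma contMDiff_incl : (ε : SignType) → (n p : ℕ) →
    ContMDiff 𝓘(ℝ, Fin n → ℝ) 𝓘(ℝ, Fin (ambDim ε n) → ℝ) ∞ (incl ε n p)
  | 0, _, _ => contMDiff_id
  | 1, n, p => quadric_contMDiff_val n p 1 one_ne_zero
  | -1, n, p => quadric_contMDiff_val n (p + 1) (-1) (neg_ne_zero.2 one_ne_zero)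

/-- The differential of the inclusion at `x`. -/
def dIncl (ε : SignType) (n p : ℕ) (x : SpaceForm ε n p) :
    TangentSpace 𝓘(ℝ, Fin n → ℝ) x →ₗ[ℝ] (Fin (ambDim ε n) → ℝ) :=
  (mfderiv 𝓘(ℝ, Fin n → ℝ) 𝓘(ℝ, Fin (ambDim ε n) → ℝ) (incl ε n p) x).toLinearMap

/-- The metric of `𝕄^n_p(ε)`, induced by the scalar product of its pseudo-Euclidean space. -/
def spaceFormMetric (ε : SignType) (n p : ℕ) : MetricField (Fin n → ℝ) (SpaceForm ε n p) :=
  fun x => (pseudoInner (ambIndex ε p) (ambDim ε n)).comp (dIncl ε n p x) (dIncl ε n p x)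

/-- `⟨h(u, v), dι ξ⟩`, where `h` is the second fundamental form of the isometric immersion
`φ : 𝕄^m_s(ε) → 𝕄^n_p(ε)`, `ι` is the inclusion of the target, and `ξ` is tangent to the target at
`φ x` and normal to `φ`. By the Gauss formula, `h(u, v)` is the component of the second derivative
of `ι ∘ φ` in a chart that is tangent to the target and normal to `φ`, so its product with such a
`ξ` is that of the second derivative. The tangent space at `x` is read in the preferred chart. -/
def secondFundamentalForm (ε : SignType) {m s n p : ℕ} (φ : SpaceForm ε m s → SpaceForm ε n p)
    (x : SpaceForm ε m s) (u v : TangentSpace 𝓘(ℝ, Fin m → ℝ) x)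
    (ξ : TangentSpace 𝓘(ℝ, Fin n → ℝ) (φ x)) : ℝ :=
  pseudoInner (ambIndex ε p) (ambDim ε n)
    (fderiv ℝ (fderiv ℝ (incl ε n p ∘ φ ∘ (chartAt (Fin m → ℝ) x).symm))
      (chartAt (Fin m → ℝ) x x) u v)
    (dIncl ε n p (φ x) ξ)

/-- The second fundamental form of `φ` vanishes identically. -/
def IsTotallyGeodesic (ε : SignType) {m s n p : ℕ}
    (φ : SpaceForm ε m s → SpaceForm ε n p) : Prop :=
  ∀ (x : SpaceForm ε m s) (u v : TangentSpace 𝓘(ℝ, Fin m → ℝ) x)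
    (ξ : TangentSpace 𝓘(ℝ, Fin n → ℝ) (φ x)),
    (∀ w : TangentSpace 𝓘(ℝ, Fin m → ℝ) x, spaceFormMetric ε n p (φ x)
      (mfderiv 𝓘(ℝ, Fin m → ℝ) 𝓘(ℝ, Fin n → ℝ) φ x w) ξ = 0) →
    secondFundamentalForm ε φ x u v ξ = 0

/-! ### The family `ψ_a` -/

/-- `(b, x_0, …, x_{q-1}, 0, …, 0, x_q, …, x_{N-1}, b) ∈ ℝ^{N'}` for `x ∈ ℝ^N`. -/
def bordered (q : ℕ) {N : ℕ} (N' : ℕ) (b : ℝ) (x : Fin N → ℝ) : Fin N' → ℝ := fun i =>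
  if (i : ℕ) = 0 ∨ (i : ℕ) + 1 = N' then b
  else if h : (i : ℕ) ≤ q ∧ (i : ℕ) - 1 < N then x ⟨(i : ℕ) - 1, h.2⟩
  else if h : N' + q ≤ (i : ℕ) + 1 + N ∧ (i : ℕ) + 1 + N - N' < N then
    x ⟨(i : ℕ) + 1 + N - N', h.2⟩
  else 0

/-- The number at both ends of `ψ_a(x)`: it is `a ⟨x, x⟩_s` for `ε = 0` and `a` for `ε = ±1`. -/
def psiEnd (ε : SignType) (m s : ℕ) (a : ℝ) (x : SpaceForm ε m s) : ℝ :=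
  if ε = 0 then a * pseudoInner (ambIndex ε s) (ambDim ε m) (incl ε m s x) (incl ε m s x) else a

end SpaceFormModuli

end

/-!
The moduli space fails to be Hausdorff because a single orbit of the isometry group accumulates at a
point outside of it. The border vector `k = (1, 0, …, 0, 1)` is null and orthogonal to the inner
coordinates, so bordering by any `b` changes no scalar product (`pseudoInner_bordered_bordered`);
hence every `ψ_a` is isometric. A boost in the Lorentzian plane of the first and the last coordinate
multiplies `k` by any prescribed `c ≠ 0` and fixes the inner coordinates
(`exists_diffeomorph_bordered`), so all `ψ_a` with `a ≠ 0` are congruent. They converge to `ψ_0`,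
because a jointly smooth family of maps depends continuously on its parameter in the compact-open
smooth topology (`tendsto_of_contMDiff_family`).

What separates `ψ_0` from `ψ_1` is the second fundamental form. It is invariant under isometries of
the target (`secondFundamentalForm_isometry_comp`). This needs no classification of the isometries
of a space form: by Koszul's argument (`bilin_fderiv_fderiv_eq_of_isometric`) the products
`⟨∂ₐ∂ᵥF, ∂_w F⟩` of a map `F` into a pseudo-Euclidean space are determined by the first fundamental
form, and this is applied to the inclusion of the target, read in a chart, before and after an
isometry. Finally `ψ_0` is totally geodesic, since the pseudo-Euclidean space is the sum of each
tangent space and the line of the position vector, while the second fundamental form of `ψ_1` is a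
nonzero multiple of the metric times `k`.
-/

noncomputable section

namespace SpaceFormModuli

/-! ### Second derivatives and bilinear forms -/

section Calculus

variable {E E' V : Type*} [NormedAddCommGroup E] [NormedSpace ℝ E] [NormedAddCommGroup E']
  [NormedSpace ℝ E'] [NormedAddCommGroup V] [NormedSpace ℝ V]

lemma two_le_infty : (2 : ℕ∞ω) ≤ ∞ := WithTop.coe_le_coe.2 (le_top (a := (2 : ℕ∞)))

lemma differentiableAt_fderiv {f : E → V} {x : E} (hf : ContDiffAt ℝ ∞ f x) :
    DifferentiableAt ℝ (fderiv ℝ f) x :=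
  (hf.fderiv_right (m := ∞) (by simp)).differentiableAt (by simp)

lemma eventually_contDiffAt {f : E → V} {x : E} (hf : ContDiffAt ℝ ∞ f x) :
    ∀ᶠ y in 𝓝 x, ContDiffAt ℝ 1 f y :=
  (hf.of_le (m := 1) (by simp)).eventually (by simp)

lemma fderiv_fderiv_comp {F : E' → V} {g : E → E'} {x : E} (hF : ContDiffAt ℝ ∞ F (g x))
    (hg : ContDiffAt ℝ ∞ g x) (u v : E) :
    fderiv ℝ (fderiv ℝ (F ∘ g)) x u v =
      fderiv ℝ (fderiv ℝ F) (g x) (fderiv ℝ g x u) (fderiv ℝ g x v) +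
        fderiv ℝ F (g x) (fderiv ℝ (fderiv ℝ g) x u v) := by
  have h : fderiv ℝ (F ∘ g) =ᶠ[𝓝 x] fun y => (fderiv ℝ F (g y)).comp (fderiv ℝ g y) := by
    filter_upwards [hg.continuousAt.eventually (eventually_contDiffAt hF),
      eventually_contDiffAt hg] with y h1 h2
    exact fderiv_comp y (h1.differentiableAt (by simp)) (h2.differentiableAt (by simp))
  have hF2 := (differentiableAt_fderiv hF).hasFDerivAt
  have hg1 := (hg.differentiableAt (by simp)).hasFDerivAt
  have h2 := (hF2.comp x hg1).clm_comp (differentiableAt_fderiv hg).hasFDerivAt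
  simp only [Function.comp_apply] at h2
  rw [h.fderiv_eq, h2.fderiv]
  simp [add_comm]

lemma fderiv_fderiv_clm_comp (L : E' →L[ℝ] V) {g : E → E'} {x : E}
    (hg : ContDiffAt ℝ ∞ g x) (u v : E) :
    fderiv ℝ (fderiv ℝ (L ∘ g)) x u v = L (fderiv ℝ (fderiv ℝ g) x u v) := by
  have h : fderiv ℝ L = fun _ => L := funext fun _ => L.fderiv
  rw [fderiv_fderiv_comp L.contDiff.contDiffAt hg, h]
  simp

lemma fderiv_bilin_apply (B : V →L[ℝ] V →L[ℝ] ℝ) {f g : E → V} {x : E}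
    (hf : DifferentiableAt ℝ f x) (hg : DifferentiableAt ℝ g x) (w : E) :
    fderiv ℝ (fun y => B (f y) (g y)) x w =
      B (f x) (fderiv ℝ g x w) + B (fderiv ℝ f x w) (g x) := by
  rw [(B.hasFDerivAt_of_bilinear hf.hasFDerivAt hg.hasFDerivAt).fderiv]
  simp

lemma fderiv_fderiv_apply {f : E → V} {x : E} (hf : ContDiffAt ℝ ∞ f x) (a v : E) :
    fderiv ℝ (fun y => fderiv ℝ f y v) x a = fderiv ℝ (fderiv ℝ f) x a v := by
  rw [((differentiableAt_fderiv hf).hasFDerivAt.clm_apply (hasFDerivAt_const v x)).fderiv]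
  simp

/-- Differentiating the coefficients `B(∂ᵥf, ∂_w f)` of the first fundamental form. -/
lemma fderiv_bilin_fderiv (B : V →L[ℝ] V →L[ℝ] ℝ) {f : E → V} {x : E}
    (hf : ContDiffAt ℝ ∞ f x) (a v w : E) :
    fderiv ℝ (fun y => B (fderiv ℝ f y v) (fderiv ℝ f y w)) x a =
      B (fderiv ℝ f x v) (fderiv ℝ (fderiv ℝ f) x a w) +
        B (fderiv ℝ (fderiv ℝ f) x a v) (fderiv ℝ f x w) := by
  have h : ∀ v, DifferentiableAt ℝ (fun y => fderiv ℝ f y v) x := fun v =>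
    (differentiableAt_fderiv hf).clm_apply (differentiableAt_const v)
  rw [fderiv_bilin_apply B (h v) (h w), fderiv_fderiv_apply hf, fderiv_fderiv_apply hf]

lemma fderiv_fderiv_bilin_self (B : V →L[ℝ] V →L[ℝ] ℝ) (hB : ∀ v w, B v w = B w v) {f : E → V}
    {x : E} (hf : ContDiffAt ℝ ∞ f x) (u v : E) :
    fderiv ℝ (fderiv ℝ fun y => B (f y) (f y)) x u v =
      2 * (B (f x) (fderiv ℝ (fderiv ℝ f) x u v) + B (fderiv ℝ f x u) (fderiv ℝ f x v)) := by
  have h1 : (fun y => fderiv ℝ (fun y => B (f y) (f y)) y v) =ᶠ[𝓝 x]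
      fun y => (2 : ℝ) * B (f y) (fderiv ℝ f y v) := by
    filter_upwards [eventually_contDiffAt hf] with y hy
    have hd := hy.differentiableAt (by simp)
    rw [fderiv_bilin_apply B hd hd, hB (fderiv ℝ f y v)]
    ring
  have hv := (differentiableAt_fderiv hf).clm_apply (differentiableAt_const v)
  have hd := hf.differentiableAt (by simp)
  have hq : ContDiffAt ℝ ∞ (fun y => B (f y) (f y)) x :=
    (B.contDiff.contDiffAt.comp x hf).clm_apply hf
  have hp : DifferentiableAt ℝ (fun y => B (f y) (fderiv ℝ f y v)) x :=
    (B.differentiableAt.comp x hd).clm_apply hv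
  rw [← fderiv_fderiv_apply hq, h1.fderiv_eq, fderiv_const_mul hp, smul_apply,
    fderiv_bilin_apply B hd hv, fderiv_fderiv_apply hf, smul_eq_mul]

lemma fderiv_fderiv_prodMk {f : E → V} {g : E → E'} {x : E} (hf : ContDiffAt ℝ ∞ f x)
    (hg : ContDiffAt ℝ ∞ g x) (u v : E) :
    fderiv ℝ (fderiv ℝ fun y => (f y, g y)) x u v =
      (fderiv ℝ (fderiv ℝ f) x u v, fderiv ℝ (fderiv ℝ g) x u v) := by
  have h := hf.prodMk hg
  exact Prod.ext (fderiv_fderiv_clm_comp (ContinuousLinearMap.fst ℝ V E') h u v).symm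
    (fderiv_fderiv_clm_comp (ContinuousLinearMap.snd ℝ V E') h u v).symm

/-- Koszul's argument: two maps that induce the same first fundamental form have the same products
`B(∂ₐ∂ᵥf, ∂_w f)`. The difference of these products is symmetric in `a, v` and antisymmetric in
`v, w`, hence zero. -/
lemma bilin_fderiv_fderiv_eq_of_isometric (B : V →L[ℝ] V →L[ℝ] ℝ) (hB : ∀ v w, B v w = B w v)
    {F X : E → V} {x : E} (hF : ContDiffAt ℝ ∞ F x) (hX : ContDiffAt ℝ ∞ X x)
    (h : ∀ᶠ y in 𝓝 x, ∀ v w,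
      B (fderiv ℝ F y v) (fderiv ℝ F y w) = B (fderiv ℝ X y v) (fderiv ℝ X y w)) (a v w : E) :
    B (fderiv ℝ (fderiv ℝ F) x a v) (fderiv ℝ F x w) =
      B (fderiv ℝ (fderiv ℝ X) x a v) (fderiv ℝ X x w) := by
  have sF : ∀ a v, fderiv ℝ (fderiv ℝ F) x a v = fderiv ℝ (fderiv ℝ F) x v a := fun a v =>
    hF.isSymmSndFDerivAt (by simpa using two_le_infty) a v
  have sX : ∀ a v, fderiv ℝ (fderiv ℝ X) x a v = fderiv ℝ (fderiv ℝ X) x v a := fun a v =>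
    hX.isSymmSndFDerivAt (by simpa using two_le_infty) a v
  have key : ∀ a v w,
      B (fderiv ℝ (fderiv ℝ F) x a w) (fderiv ℝ F x v) +
        B (fderiv ℝ (fderiv ℝ F) x a v) (fderiv ℝ F x w) =
      B (fderiv ℝ (fderiv ℝ X) x a w) (fderiv ℝ X x v) +
        B (fderiv ℝ (fderiv ℝ X) x a v) (fderiv ℝ X x w) := by
    intro a v w
    have h1 : (fun y => B (fderiv ℝ F y v) (fderiv ℝ F y w)) =ᶠ[𝓝 x]
        fun y => B (fderiv ℝ X y v) (fderiv ℝ X y w) := h.mono fun y hy => hy v w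
    have h2 := DFunLike.congr_fun (h1.fderiv_eq (𝕜 := ℝ)) a
    rw [fderiv_bilin_fderiv B hF, fderiv_bilin_fderiv B hX] at h2
    rw [hB _ (fderiv ℝ F x v), hB _ (fderiv ℝ X x v)]
    exact h2
  have k1 := key a v w
  have k2 := key v a w
  have k3 := key w a v
  rw [sF v a, sX v a] at k2
  rw [sF w a, sX w a, sF w v, sX w v] at k3
  linarith

lemma bilin_fderiv_fderiv_comp_eq_of_isometric (B : V →L[ℝ] V →L[ℝ] ℝ)
    (hB : ∀ v w, B v w = B w v) {F X : E' → V} {g : E → E'} {x : E}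
    (hF : ContDiffAt ℝ ∞ F (g x)) (hX : ContDiffAt ℝ ∞ X (g x)) (hg : ContDiffAt ℝ ∞ g x)
    (h : ∀ᶠ y in 𝓝 (g x), ∀ v w,
      B (fderiv ℝ F y v) (fderiv ℝ F y w) = B (fderiv ℝ X y v) (fderiv ℝ X y w))
    (u v : E) (w : E') :
    B (fderiv ℝ (fderiv ℝ (F ∘ g)) x u v) (fderiv ℝ F (g x) w) =
      B (fderiv ℝ (fderiv ℝ (X ∘ g)) x u v) (fderiv ℝ X (g x) w) := by
  rw [fderiv_fderiv_comp hF hg, fderiv_fderiv_comp hX hg, map_add, map_add, add_apply, add_apply,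
    bilin_fderiv_fderiv_eq_of_isometric B hB hF hX h, h.self_of_nhds]

/-- A jointly smooth family of maps has jointly smooth iterated derivatives. -/
lemma contDiffAt_iteratedFDeriv_param {P : Type*} [NormedAddCommGroup P] [NormedSpace ℝ P]
    {G : P → E → V} {a : P} {x : E} (hG : ContDiffAt ℝ ∞ (Function.uncurry G) (a, x)) (k : ℕ) :
    ContDiffAt ℝ ∞ (fun z : P × E => iteratedFDeriv ℝ k (G z.1) z.2) (a, x) := by
  induction k with
  | zero =>
    have : (fun z : P × E => iteratedFDeriv ℝ 0 (G z.1) z.2) =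
        (continuousMultilinearCurryFin0 ℝ E V).symm ∘ Function.uncurry G := by
      funext z; rfl
    rw [this]
    exact (continuousMultilinearCurryFin0 ℝ E V).symm.contDiff.contDiffAt.comp _ hG
  | succ k ih =>
    have h : ContDiffAt ℝ ∞ (fun z : P × E => fderiv ℝ (iteratedFDeriv ℝ k (G z.1)) z.2) (a, x) := by
      refine ContDiffAt.fderiv (n := ∞) (f := fun z : P × E => iteratedFDeriv ℝ k (G z.1))
        (g := Prod.snd) ?_ contDiffAt_snd (by simp)
      exact ih.comp ((a, x), x) (f := fun z : (P × E) × E => (z.1.1, z.2))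
        (contDiffAt_fst.fst.prodMk contDiffAt_snd)
    simp_rw [iteratedFDeriv_succ_eq_comp_left]
    exact h.continuousLinearMap_comp
      ((continuousMultilinearCurryLeftEquiv ℝ (fun _ : Fin (k + 1) => E) V).symm :
        _ →L[ℝ] E [×(k + 1)]→L[ℝ] V)

end Calculus

/-! ### The algebra of the bordered vectors -/

lemma pseudoInner_comm (q N : ℕ) (x y : Fin N → ℝ) :
    pseudoInner q N x y = pseudoInner q N y x := by
  simp only [pseudoInner_apply, mul_comm]

lemma pseudoInner_single {q N : ℕ} (i : Fin N) (x : Fin N → ℝ) :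
    pseudoInner q N (Pi.single i 1) x = eta q i * x i := by
  rw [pseudoInner_apply, Finset.sum_eq_single i]
  · simp
  · intro j _ hj; simp [hj]
  · simp

lemma eq_zero_of_pseudoInner_eq_zero {q N : ℕ} {x : Fin N → ℝ}
    (h : ∀ y, pseudoInner q N y x = 0) : x = 0 := by
  funext i
  have h1 := h (Pi.single i 1)
  rw [pseudoInner_single] at h1
  exact (mul_eq_zero.1 h1).resolve_left fun h0 => by simpa [h0] using eta_mul_self q i

/-- The place in `bordered q N' b x` of the coordinate `x_j`. -/
def innerIndex (q : ℕ) {N N' : ℕ} (hN : N + 2 ≤ N') (j : Fin N) : Fin N' :=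
  ⟨if (j : ℕ) < q then j + 1 else j + (N' - 1 - N), by split_ifs <;> omega⟩

section Bordered

variable {q p N N' : ℕ}

lemma bordered_innerIndex (hN : N + 2 ≤ N') (b : ℝ) (x : Fin N → ℝ) (j : Fin N) :
    bordered q N' b x (innerIndex q hN j) = x j := by
  have hj := j.2
  unfold bordered innerIndex
  by_cases h : (j : ℕ) < q
  · simp only [h, if_true]
    rw [if_neg (by omega), dif_pos ⟨by omega, by omega⟩]
    rfl
  · simp only [h, if_false]
    rw [if_neg (by omega)]
    by_cases h' : (j : ℕ) + (N' - 1 - N) ≤ q ∧ (j : ℕ) + (N' - 1 - N) - 1 < N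
    · omega
    · rw [dif_neg h', dif_pos ⟨by omega, by omega⟩]
      congr 1
      ext
      simp only
      omega

/-- The inner product with a bordered vector, when the first entry is timelike, the last one is
spacelike, and the inner coordinates keep their signs. -/
lemma pseudoInner_bordered (hN : N + 2 ≤ N') (hp : q + 1 ≤ p) (hq : N + 1 + p ≤ N' + q)
    (hqN : q ≤ N) (z : Fin N' → ℝ) (b : ℝ) (x : Fin N → ℝ) :
    pseudoInner p N' z (bordered q N' b x) =
      (z ⟨N' - 1, by omega⟩ - z ⟨0, by omega⟩) * b +
        ∑ j, eta q j * (z (innerIndex q hN j) * x j) := by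
  let e : Fin N ⊕ Bool → Fin N' := Sum.elim (innerIndex q hN)
    fun t => if t then ⟨N' - 1, by omega⟩ else ⟨0, by omega⟩
  let f : Fin N ⊕ Bool → ℝ := Sum.elim (fun j => eta q j * (z (innerIndex q hN j) * x j))
    fun t => if t then z ⟨N' - 1, by omega⟩ * b else -(z ⟨0, by omega⟩ * b)
  have key : ∑ t, f t = ∑ i, eta p i * (z i * bordered q N' b x i) := by
    refine Finset.sum_of_injOn e ?_ (fun _ _ => Finset.mem_univ _) ?_ ?_
    · rintro (j | j) - (k | k) - hjk
      · have h1 := congrArg Fin.val hjk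
        have hj := j.2
        have hk := k.2
        simp only [e, Sum.elim_inl, innerIndex] at h1
        congr 1
        ext
        split_ifs at h1 <;> omega
      · have h1 := congrArg Fin.val hjk
        have hj := j.2
        exfalso
        cases k <;> simp only [e, Sum.elim_inl, Sum.elim_inr, innerIndex] at h1 <;>
          split_ifs at h1 <;> simp at * <;> omega
      · have h1 := congrArg Fin.val hjk
        have hk := k.2
        exfalso
        cases j <;> simp only [e, Sum.elim_inl, Sum.elim_inr, innerIndex] at h1 <;>
          split_ifs at h1 <;> simp at * <;> omega
      · have h1 := congrArg Fin.val hjk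
        cases j <;> cases k <;> simp [e] at h1 <;> first | rfl | omega
    · intro i _ hi
      have hi' : ∀ t, e t ≠ i := by simpa using hi
      have h0 : (i : ℕ) ≠ 0 := fun h => hi' (Sum.inr false) (by ext; simp [e, h])
      have h1 : (i : ℕ) + 1 ≠ N' := fun h => hi' (Sum.inr true) (by ext; simp [e]; omega)
      have : bordered q N' b x i = 0 := by
        unfold bordered
        rw [if_neg (by omega), dif_neg, dif_neg]
        · rintro ⟨h2, h3⟩
          apply hi' (Sum.inl ⟨(i : ℕ) + 1 + N - N', h3⟩)
          ext
          simp only [e, Sum.elim_inl, innerIndex]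
          split_ifs <;> omega
        · rintro ⟨h2, h3⟩
          apply hi' (Sum.inl ⟨(i : ℕ) - 1, h3⟩)
          ext
          simp only [e, Sum.elim_inl, innerIndex]
          split_ifs <;> omega
      rw [this, mul_zero, mul_zero]
    · rintro (j | t) -
      · have he : eta p (innerIndex q hN j) = eta q j := by
          have hj := j.2
          unfold eta innerIndex
          by_cases h : (j : ℕ) < q
          · simp only [h, if_true]; rw [if_pos (by omega)]
          · simp only [h, if_false]; rw [if_neg (by omega)]
        simp only [f, e, Sum.elim_inl, he, bordered_innerIndex]
      · cases t
        · have h1 : eta p (⟨0, by omega⟩ : Fin N') = -1 := if_pos (by simp; omega)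
          have h2 : bordered q N' b x ⟨0, by omega⟩ = b := if_pos (Or.inl rfl)
          simp [f, e, h1, h2]
        · have h1 : eta p (⟨N' - 1, by omega⟩ : Fin N') = 1 := if_neg (by simp; omega)
          have h2 : bordered q N' b x ⟨N' - 1, by omega⟩ = b :=
            if_pos (Or.inr (by simp only; omega))
          simp [f, e, h1, h2]
  rw [pseudoInner_apply, ← key, Fintype.sum_sum_type, Fintype.sum_bool]
  simp only [f, Sum.elim_inl, Sum.elim_inr, if_true]
  simp
  ring

lemma pseudoInner_bordered_bordered (hN : N + 2 ≤ N') (hp : q + 1 ≤ p)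
    (hq : N + 1 + p ≤ N' + q) (hqN : q ≤ N) (b c : ℝ) (x y : Fin N → ℝ) :
    pseudoInner p N' (bordered q N' b x) (bordered q N' c y) = pseudoInner q N x y := by
  have h1 : bordered q N' b x ⟨0, by omega⟩ = b := if_pos (Or.inl rfl)
  have h2 : bordered q N' b x ⟨N' - 1, by omega⟩ = b := if_pos (Or.inr (by simp only; omega))
  rw [pseudoInner_bordered hN hp hq hqN, h1, h2, pseudoInner_apply]
  simp only [bordered_innerIndex]
  ring

lemma pseudoInner_single_zero_bordered (hN : 0 < N') (hp : q + 1 ≤ p) (b : ℝ) (x : Fin N → ℝ) :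
    pseudoInner p N' (Pi.single ⟨0, hN⟩ 1) (bordered q N' b x) = -b := by
  have h1 : eta p (⟨0, hN⟩ : Fin N') = -1 := if_pos (by simp only; omega)
  have h2 : bordered q N' b x ⟨0, hN⟩ = b := if_pos (Or.inl rfl)
  rw [pseudoInner_single, h1, h2]
  ring

/-- `bordered` is linear in the pair of the border and the inner vector. -/
def borderedCLM (q N N' : ℕ) : ℝ × (Fin N → ℝ) →L[ℝ] (Fin N' → ℝ) :=
  LinearMap.toContinuousLinearMap
    { toFun := fun z => bordered q N' z.1 z.2
      map_add' := fun z w => by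
        funext i
        simp only [bordered, Pi.add_apply, Prod.fst_add, Prod.snd_add]
        split_ifs <;> simp
      map_smul' := fun c z => by
        funext i
        simp only [bordered, Pi.smul_apply, Prod.smul_fst, Prod.smul_snd, RingHom.id_apply]
        split_ifs <;> simp }

lemma borderedCLM_apply (z : ℝ × (Fin N → ℝ)) :
    borderedCLM q N N' z = bordered q N' z.1 z.2 := rfl

end Bordered

/-! ### Boosts -/

/-- For null vectors `k`, `l` with `B(k, l) = -2`, the linear map that multiplies `k` by `c`,
divides `l` by `c`, and fixes the orthogonal complement of both. -/
def boost {V : Type*} [AddCommGroup V] [Module ℝ V] (B : LinearMap.BilinForm ℝ V) (k l : V)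
    (c : ℝ) : V →ₗ[ℝ] V :=
  LinearMap.id + (((1 - c) / 2) • (B l).smulRight k + ((1 - c⁻¹) / 2) • (B k).smulRight l)

section Boost

variable {V : Type*} [AddCommGroup V] [Module ℝ V] {B : LinearMap.BilinForm ℝ V} {k l : V}

lemma boost_apply (c : ℝ) (v : V) :
    boost B k l c v = v + (((1 - c) / 2 * B l v) • k + ((1 - c⁻¹) / 2 * B k v) • l) := by
  simp [boost, smul_smul]

lemma bilin_boost_boost (hB : ∀ v w, B v w = B w v) (hk : B k k = 0) (hl : B l l = 0)
    (hkl : B k l = -2) {c : ℝ} (hc : c ≠ 0) (v w : V) :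
    B (boost B k l c v) (boost B k l c w) = B v w := by
  have hlk : B l k = -2 := by rw [hB, hkl]
  simp only [boost_apply, map_add, map_smul, LinearMap.add_apply, LinearMap.smul_apply,
    smul_eq_mul, hk, hl, hkl, hlk, hB v k, hB v l]
  field_simp
  ring

lemma boost_boost_inv (hB : ∀ v w, B v w = B w v) (hk : B k k = 0) (hl : B l l = 0)
    (hkl : B k l = -2) {c : ℝ} (hc : c ≠ 0) (v : V) :
    boost B k l c (boost B k l c⁻¹ v) = v := by
  have hlk : B l k = -2 := by rw [hB, hkl]
  simp only [boost_apply, map_add, map_smul, hk, hl, hkl, hlk, inv_inv]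
  match_scalars <;> field_simp <;> ring

end Boost

/-! ### The inclusion of a space form into its pseudo-Euclidean space -/

/-- The scalar product of the pseudo-Euclidean space containing `𝕄^n_p(ε)`. -/
abbrev ambForm (ε : SignType) (n p : ℕ) : LinearMap.BilinForm ℝ (Fin (ambDim ε n) → ℝ) :=
  pseudoInner (ambIndex ε p) (ambDim ε n)

/-- `ambForm` as a continuous bilinear map. -/
def ambFormL (ε : SignType) (n p : ℕ) :
    (Fin (ambDim ε n) → ℝ) →L[ℝ] (Fin (ambDim ε n) → ℝ) →L[ℝ] ℝ :=
  LinearMap.toContinuousBilinearMap (ambForm ε n p)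

lemma ambFormL_apply (ε : SignType) (n p : ℕ) (x y : Fin (ambDim ε n) → ℝ) :
    ambFormL ε n p x y = ambForm ε n p x y := rfl

lemma ambFormL_comm (ε : SignType) (n p : ℕ) (x y : Fin (ambDim ε n) → ℝ) :
    ambFormL ε n p x y = ambFormL ε n p y x := pseudoInner_comm _ _ _ _

lemma contDiff_ambForm_self (ε : SignType) (n p : ℕ) :
    ContDiff ℝ ∞ fun y => ambForm ε n p y y := by
  simp only [pseudoInner_apply]
  fun_prop

lemma coe_ne_zero {ε : SignType} (hε : ε ≠ 0) : ((ε : SignType) : ℝ) ≠ 0 := by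
  match ε with
  | 0 => exact absurd rfl hε
  | 1 => simp
  | -1 => simp

lemma ambForm_incl_self : {ε : SignType} → (hε : ε ≠ 0) → {n p : ℕ} → (x : SpaceForm ε n p) →
    ambForm ε n p (incl ε n p x) (incl ε n p x) = (ε : ℝ)
  | 0, h, _, _, _ => absurd rfl h
  | 1, _, _, _, x => x.2.trans (by simp)
  | -1, _, _, _, x => x.2.trans (by simp)

lemma exists_incl_eq : {ε : SignType} → {n p : ℕ} → (y : Fin (ambDim ε n) → ℝ) →
    (ε ≠ 0 → ambForm ε n p y y = (ε : ℝ)) → ∃ x : SpaceForm ε n p, incl ε n p x = y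
  | 0, _, _, y, _ => ⟨y, rfl⟩
  | 1, _, _, y, h => ⟨⟨y, (h (by decide)).trans (by simp)⟩, rfl⟩
  | -1, _, _, y, h => ⟨⟨y, (h (by decide)).trans (by simp)⟩, rfl⟩

lemma incl_injective : (ε : SignType) → (n p : ℕ) → Function.Injective (incl ε n p)
  | 0, _, _ => fun _ _ h => h
  | 1, _, _ => Subtype.val_injective
  | -1, _, _ => Subtype.val_injective

lemma isInducing_incl : (ε : SignType) → (n p : ℕ) → Topology.IsInducing (incl ε n p)
  | 0, _, _ => Topology.IsInducing.id
  | 1, _, _ => Topology.IsInducing.subtypeVal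
  | -1, _, _ => Topology.IsInducing.subtypeVal

/-- The preferred charts of a space form are restrictions of linear maps: they are coordinate
projections. -/
lemma exists_chartAt_eq : (ε : SignType) → (n p : ℕ) → (x : SpaceForm ε n p) →
    ∃ P : (Fin (ambDim ε n) → ℝ) →L[ℝ] (Fin n → ℝ),
      ∀ z, chartAt (Fin n → ℝ) x z = P (incl ε n p z)
  | 0, n, _, _ => ⟨ContinuousLinearMap.id ℝ (Fin n → ℝ), fun _ => rfl⟩
  | 1, _, _, x => ⟨ContinuousLinearMap.pi fun j => ContinuousLinearMap.proj
      ((Quadric.exists_ne_zero one_ne_zero x).choose.succAbove j), fun _ => rfl⟩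
  | -1, _, _, x => ⟨ContinuousLinearMap.pi fun j => ContinuousLinearMap.proj
      ((Quadric.exists_ne_zero (neg_ne_zero.2 one_ne_zero) x).choose.succAbove j), fun _ => rfl⟩

lemma contMDiffAt_of_incl {E H M : Type*} [NormedAddCommGroup E] [NormedSpace ℝ E]
    [TopologicalSpace H] {I : ModelWithCorners ℝ E H} [TopologicalSpace M] [ChartedSpace H M]
    {ε : SignType} {n p : ℕ} {f : M → SpaceForm ε n p} {x : M}
    (h : ContMDiffAt I 𝓘(ℝ, Fin (ambDim ε n) → ℝ) ∞ (incl ε n p ∘ f) x) :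
    ContMDiffAt I 𝓘(ℝ, Fin n → ℝ) ∞ f x := by
  rw [contMDiffAt_iff_target]
  refine ⟨(isInducing_incl ε n p).continuousAt_iff.2 h.continuousAt, ?_⟩
  obtain ⟨P, hP⟩ := exists_chartAt_eq ε n p (f x)
  have : extChartAt 𝓘(ℝ, Fin n → ℝ) (f x) ∘ f = P ∘ (incl ε n p ∘ f) := by
    funext z
    simp [hP]
  rw [this]
  exact P.contMDiff.contMDiffAt.comp x h

lemma contMDiff_of_incl {E H M : Type*} [NormedAddCommGroup E] [NormedSpace ℝ E]
    [TopologicalSpace H] {I : ModelWithCorners ℝ E H} [TopologicalSpace M] [ChartedSpace H M]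
    {ε : SignType} {n p : ℕ} {f : M → SpaceForm ε n p}
    (h : ContMDiff I 𝓘(ℝ, Fin (ambDim ε n) → ℝ) ∞ (incl ε n p ∘ f)) :
    ContMDiff I 𝓘(ℝ, Fin n → ℝ) ∞ f := fun x => contMDiffAt_of_incl (h x)

lemma mfderiv_incl_comp {E H M : Type*} [NormedAddCommGroup E] [NormedSpace ℝ E]
    [TopologicalSpace H] {I : ModelWithCorners ℝ E H} [TopologicalSpace M] [ChartedSpace H M]
    {ε : SignType} {n p : ℕ} {f : M → SpaceForm ε n p} {x : M}
    (hf : MDifferentiableAt I 𝓘(ℝ, Fin n → ℝ) f x) (v : TangentSpace I x) :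
    mfderiv I 𝓘(ℝ, Fin (ambDim ε n) → ℝ) (incl ε n p ∘ f) x v =
      dIncl ε n p (f x) (mfderiv I 𝓘(ℝ, Fin n → ℝ) f x v) := by
  rw [mfderiv_comp x ((contMDiff_incl ε n p).mdifferentiable (by simp) _) hf]
  rfl

/-- The inverse of the preferred chart at `x`, as a map into the pseudo-Euclidean space. -/
def param (ε : SignType) (n p : ℕ) (x : SpaceForm ε n p) : (Fin n → ℝ) → Fin (ambDim ε n) → ℝ :=
  incl ε n p ∘ (chartAt (Fin n → ℝ) x).symm

variable {ε : SignType} {m s n p : ℕ}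

lemma contMDiffAt_chartAt_symm (x : SpaceForm ε n p) {y : Fin n → ℝ}
    (hy : y ∈ (chartAt (Fin n → ℝ) x).target) :
    ContMDiffAt 𝓘(ℝ, Fin n → ℝ) 𝓘(ℝ, Fin n → ℝ) ∞ (chartAt (Fin n → ℝ) x).symm y :=
  (contMDiffOn_chart_symm (I := 𝓘(ℝ, Fin n → ℝ)) (x := x)).contMDiffAt
    ((chartAt (Fin n → ℝ) x).open_target.mem_nhds hy)

lemma contDiffAt_param (x : SpaceForm ε n p) {y : Fin n → ℝ}
    (hy : y ∈ (chartAt (Fin n → ℝ) x).target) : ContDiffAt ℝ ∞ (param ε n p x) y :=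
  ((contMDiff_incl ε n p).contMDiffAt.comp y (contMDiffAt_chartAt_symm x hy)).contDiffAt

lemma contDiffAt_param_self (x : SpaceForm ε n p) :
    ContDiffAt ℝ ∞ (param ε n p x) (chartAt (Fin n → ℝ) x x) :=
  contDiffAt_param x (mem_chart_target _ x)

lemma param_chartAt (x : SpaceForm ε n p) :
    param ε n p x (chartAt (Fin n → ℝ) x x) = incl ε n p x := by
  simp [param]

/-- The differential at `x` is the derivative of the representative in the preferred chart. -/
lemma mfderiv_eq_fderiv_chartAt {V : Type*} [NormedAddCommGroup V] [NormedSpace ℝ V]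
    {f : SpaceForm ε n p → V} {x : SpaceForm ε n p}
    (hf : MDifferentiableAt 𝓘(ℝ, Fin n → ℝ) 𝓘(ℝ, V) f x)
    (w : TangentSpace 𝓘(ℝ, Fin n → ℝ) x) :
    mfderiv 𝓘(ℝ, Fin n → ℝ) 𝓘(ℝ, V) f x w =
      fderiv ℝ (f ∘ (chartAt (Fin n → ℝ) x).symm) (chartAt (Fin n → ℝ) x x) w := by
  simp only [mfderiv, hf]
  simp only [mfld_simps, fderivWithin_univ]
  rfl

lemma dIncl_eq_fderiv (x : SpaceForm ε n p) (w : TangentSpace 𝓘(ℝ, Fin n → ℝ) x) :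
    dIncl ε n p x w = fderiv ℝ (param ε n p x) (chartAt (Fin n → ℝ) x x) w :=
  mfderiv_eq_fderiv_chartAt ((contMDiff_incl ε n p).mdifferentiable (by simp) _) w

lemma fderiv_param (x : SpaceForm ε n p) {y : Fin n → ℝ}
    (hy : y ∈ (chartAt (Fin n → ℝ) x).target) (w : Fin n → ℝ) :
    fderiv ℝ (param ε n p x) y w = dIncl ε n p ((chartAt (Fin n → ℝ) x).symm y)
      (mfderiv 𝓘(ℝ, Fin n → ℝ) 𝓘(ℝ, Fin n → ℝ) (chartAt (Fin n → ℝ) x).symm y w) := by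
  rw [← mfderiv_incl_comp ((contMDiffAt_chartAt_symm x hy).mdifferentiableAt (by simp)) w,
    mfderiv_eq_fderiv]
  rfl

lemma dIncl_injective (x : SpaceForm ε n p) : Function.Injective (dIncl ε n p x) := by
  obtain ⟨P, hP⟩ := exists_chartAt_eq ε n p x
  have h : P ∘ param ε n p x =ᶠ[𝓝 (chartAt (Fin n → ℝ) x x)] id := by
    filter_upwards [(chartAt (Fin n → ℝ) x).open_target.mem_nhds (mem_chart_target _ x)] with y hy
    simp only [param, Function.comp_apply, ← hP, id]
    exact (chartAt (Fin n → ℝ) x).right_inv hy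
  have h2 := P.hasFDerivAt.comp _
    ((contDiffAt_param_self x).differentiableAt (by simp)).hasFDerivAt
  have h3 := h2.fderiv.symm.trans (h.fderiv_eq.trans fderiv_id)
  exact Function.LeftInverse.injective (g := P) fun w : Fin n → ℝ =>
    (congrArg P (dIncl_eq_fderiv x w)).trans (DFunLike.congr_fun h3 w)

lemma ambForm_param_fderiv_param (hε : ε ≠ 0) (x : SpaceForm ε n p) {y : Fin n → ℝ}
    (hy : y ∈ (chartAt (Fin n → ℝ) x).target) (w : Fin n → ℝ) :
    ambForm ε n p (param ε n p x y) (fderiv ℝ (param ε n p x) y w) = 0 := by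
  have hX := (contDiffAt_param x hy).differentiableAt (by simp)
  have h2 : (fun y => ambFormL ε n p (param ε n p x y) (param ε n p x y)) = fun _ => (ε : ℝ) :=
    funext fun y => ambForm_incl_self hε _
  have h3 := fderiv_bilin_apply (ambFormL ε n p) hX hX w
  rw [h2, fderiv_fun_const, ambFormL_comm ε n p (fderiv ℝ (param ε n p x) y w)] at h3
  rw [← ambFormL_apply]
  simp only [Pi.zero_apply, zero_apply] at h3
  linarith

/-- The position vector is normal to a quadric. -/
lemma ambForm_incl_dIncl (hε : ε ≠ 0) (x : SpaceForm ε n p)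
    (w : TangentSpace 𝓘(ℝ, Fin n → ℝ) x) :
    ambForm ε n p (incl ε n p x) (dIncl ε n p x w) = 0 := by
  rw [dIncl_eq_fderiv, ← param_chartAt]
  exact ambForm_param_fderiv_param hε x (mem_chart_target _ x) w

/-- The component of the second derivative of a parametrization of a quadric along the position
vector. -/
lemma ambForm_param_fderiv_fderiv (hε : ε ≠ 0) (x : SpaceForm ε n p) (u v : Fin n → ℝ) :
    ambForm ε n p (incl ε n p x)
      (fderiv ℝ (fderiv ℝ (param ε n p x)) (chartAt (Fin n → ℝ) x x) u v) =
        -ambForm ε n p (fderiv ℝ (param ε n p x) (chartAt (Fin n → ℝ) x x) u)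
          (fderiv ℝ (param ε n p x) (chartAt (Fin n → ℝ) x x) v) := by
  have h := fderiv_fderiv_bilin_self (ambFormL ε n p) (ambFormL_comm ε n p)
    (contDiffAt_param_self x) u v
  have h2 : (fun y => ambFormL ε n p (param ε n p x y) (param ε n p x y)) = fun _ => (ε : ℝ) :=
    funext fun y => ambForm_incl_self hε _
  rw [h2, param_chartAt, ambFormL_apply, ambFormL_apply] at h
  simp at h
  linarith

lemma dIncl_surjective_zero (x : SpaceForm 0 n p) : Function.Surjective (dIncl 0 n p x) :=
  (LinearMap.injective_iff_surjective (K := ℝ) (V := Fin n → ℝ)).1 (dIncl_injective x)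

lemma ambDim_of_ne_zero (hε : ε ≠ 0) : ambDim ε n = n + 1 := by
  match ε with
  | 0 => exact absurd rfl hε
  | 1 => rfl
  | -1 => rfl

lemma exists_eq_add_smul_of_finrank_eq {V W : Type*} [AddCommGroup V] [Module ℝ V]
    [FiniteDimensional ℝ V] [AddCommGroup W] [Module ℝ W] [FiniteDimensional ℝ W]
    (hVW : Module.finrank ℝ W = Module.finrank ℝ V + 1) (B : LinearMap.BilinForm ℝ W)
    (L : V →ₗ[ℝ] W) (hL : Function.Injective L) {x : W} (hx : B x x ≠ 0)
    (hxL : ∀ v, B x (L v) = 0) (z : W) : ∃ (v : V) (t : ℝ), z = L v + t • x := by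
  let T : V × ℝ →ₗ[ℝ] W := LinearMap.coprod L (LinearMap.toSpanSingleton ℝ _ x)
  have hT : ∀ w t, T (w, t) = L w + t • x := fun w t => rfl
  have hinj : Function.Injective T := by
    rw [← LinearMap.ker_eq_bot, LinearMap.ker_eq_bot']
    rintro ⟨w, t⟩ h
    rw [hT] at h
    have h1 := congrArg (B x) h
    rw [map_add, map_smul, hxL, map_zero, zero_add, smul_eq_mul] at h1
    have ht : t = 0 := (mul_eq_zero.1 h1).resolve_right hx
    rw [ht, zero_smul, add_zero] at h
    rw [ht, hL (h.trans (map_zero L).symm)]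
    rfl
  obtain ⟨⟨w, t⟩, h⟩ := (LinearMap.injective_iff_surjective_of_finrank_eq_finrank
    (by simp [hVW])).1 hinj z
  exact ⟨w, t, h.symm⟩

/-- The pseudo-Euclidean space is the sum of the tangent space and the line of the position vector;
for `ε = 0` the tangent space suffices. -/
lemma exists_dIncl_add (x : SpaceForm ε n p) (z : Fin (ambDim ε n) → ℝ) :
    ∃ (w : TangentSpace 𝓘(ℝ, Fin n → ℝ) x) (t : ℝ),
      z = dIncl ε n p x w + t • incl ε n p x ∧ (ε = 0 → t = 0) := by
  by_cases hε : ε = 0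
  · subst hε
    obtain ⟨w, hw⟩ := dIncl_surjective_zero x z
    exact ⟨w, 0, by simp [hw], fun _ => rfl⟩
  · let L : (Fin n → ℝ) →ₗ[ℝ] (Fin (ambDim ε n) → ℝ) := dIncl ε n p x
    obtain ⟨w, t, h⟩ := exists_eq_add_smul_of_finrank_eq
      (by simp [ambDim_of_ne_zero hε]) (ambForm ε n p) L (dIncl_injective x)
      (by rw [ambForm_incl_self hε]; exact coe_ne_zero hε) (ambForm_incl_dIncl hε x) z
    exact ⟨w, t, h, fun h => absurd h hε⟩

lemma exists_dIncl_eq (x : SpaceForm ε n p) {z : Fin (ambDim ε n) → ℝ}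
    (hz : ε ≠ 0 → ambForm ε n p (incl ε n p x) z = 0) :
    ∃ w : TangentSpace 𝓘(ℝ, Fin n → ℝ) x, dIncl ε n p x w = z := by
  obtain ⟨w, t, h, ht⟩ := exists_dIncl_add x z
  have : t = 0 := by
    by_cases hε : ε = 0
    · exact ht hε
    · have h1 := hz hε
      rw [h, map_add, map_smul, ambForm_incl_dIncl hε, ambForm_incl_self hε, zero_add,
        smul_eq_mul] at h1
      exact (mul_eq_zero.1 h1).resolve_right (coe_ne_zero hε)
  exact ⟨w, by rw [h, this, zero_smul, add_zero]⟩

/-- The metric of a space form of positive dimension is not zero. -/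
lemma exists_ambForm_dIncl_ne_zero (hn : 1 ≤ n) (x : SpaceForm ε n p) :
    ∃ u v : TangentSpace 𝓘(ℝ, Fin n → ℝ) x,
      ambForm ε n p (dIncl ε n p x u) (dIncl ε n p x v) ≠ 0 := by
  by_contra! h
  let v : TangentSpace 𝓘(ℝ, Fin n → ℝ) x := (Pi.single ⟨0, hn⟩ 1 : Fin n → ℝ)
  have h1 : dIncl ε n p x v = 0 := by
    refine eq_zero_of_pseudoInner_eq_zero (q := ambIndex ε p) fun z => ?_
    obtain ⟨w, t, rfl, ht⟩ := exists_dIncl_add x z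
    rw [map_add, map_smul, LinearMap.add_apply, LinearMap.smul_apply]
    have h2 : t * ambForm ε n p (incl ε n p x) (dIncl ε n p x v) = 0 := by
      by_cases hε : ε = 0
      · rw [ht hε, zero_mul]
      · rw [ambForm_incl_dIncl hε, mul_zero]
    rw [smul_eq_mul, h2, add_zero]
    exact h w v
  have h2 : v = 0 := dIncl_injective x (h1.trans (map_zero _).symm)
  have h3 : (Pi.single ⟨0, hn⟩ 1 : Fin n → ℝ) ⟨0, hn⟩ = 0 := congrFun h2 ⟨0, hn⟩
  simp at h3

/-! ### Maps of space forms that extend to the pseudo-Euclidean spaces -/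

/-- A smooth map of pseudo-Euclidean spaces that preserves the values `⟨y, y⟩` restricts to a smooth
map of the space forms. -/
lemma exists_contMDiffMap (Q : (Fin (ambDim ε m) → ℝ) → Fin (ambDim ε n) → ℝ)
    (hQ : ContDiff ℝ ∞ Q) (h : ∀ y, ambForm ε n p (Q y) (Q y) = ambForm ε m s y y) :
    ∃ f : C^∞⟮𝓘(ℝ, Fin m → ℝ), SpaceForm ε m s; 𝓘(ℝ, Fin n → ℝ), SpaceForm ε n p⟯,
      ∀ x, incl ε n p (f x) = Q (incl ε m s x) := by
  choose f hf using fun x : SpaceForm ε m s => exists_incl_eq (p := p) (Q (incl ε m s x))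
    fun hε => (h _).trans (ambForm_incl_self hε x)
  exact ⟨⟨f, contMDiff_of_incl ((hQ.contMDiff.comp (contMDiff_incl ε m s)).congr hf)⟩, hf⟩

lemma dIncl_mfderiv {Q : (Fin (ambDim ε m) → ℝ) → Fin (ambDim ε n) → ℝ} (hQ : ContDiff ℝ ∞ Q)
    {f : SpaceForm ε m s → SpaceForm ε n p}
    (hf : ContMDiff 𝓘(ℝ, Fin m → ℝ) 𝓘(ℝ, Fin n → ℝ) ∞ f)
    (h : ∀ x, incl ε n p (f x) = Q (incl ε m s x)) (x : SpaceForm ε m s)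
    (v : TangentSpace 𝓘(ℝ, Fin m → ℝ) x) :
    dIncl ε n p (f x) (mfderiv 𝓘(ℝ, Fin m → ℝ) 𝓘(ℝ, Fin n → ℝ) f x v) =
      fderiv ℝ Q (incl ε m s x) (dIncl ε m s x v) := by
  have hfg : incl ε n p ∘ f = Q ∘ incl ε m s := funext h
  rw [← mfderiv_incl_comp (hf.mdifferentiable (by simp) x), hfg,
    mfderiv_comp x (hQ.contMDiff.mdifferentiable (by simp) _)
      ((contMDiff_incl ε m s).mdifferentiable (by simp) x), mfderiv_eq_fderiv]
  rfl

lemma isIsometric_of_incl {Q : (Fin (ambDim ε m) → ℝ) → Fin (ambDim ε n) → ℝ}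
    (hQ : ContDiff ℝ ∞ Q)
    (hd : ∀ y u v, ambForm ε n p (fderiv ℝ Q y u) (fderiv ℝ Q y v) = ambForm ε m s u v)
    {f : SpaceForm ε m s → SpaceForm ε n p}
    (hf : ContMDiff 𝓘(ℝ, Fin m → ℝ) 𝓘(ℝ, Fin n → ℝ) ∞ f)
    (h : ∀ x, incl ε n p (f x) = Q (incl ε m s x)) :
    IsIsometric (spaceFormMetric ε m s) (spaceFormMetric ε n p) f := by
  intro x v w
  change ambForm ε n p (dIncl ε n p (f x) _) (dIncl ε n p (f x) _) =
    ambForm ε m s (dIncl ε m s x v) (dIncl ε m s x w)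
  rw [dIncl_mfderiv hQ hf h, dIncl_mfderiv hQ hf h, hd]

/-! ### Isometries preserve the second fundamental form -/

/-- The second fundamental form is invariant under isometries of the target. -/
lemma secondFundamentalForm_isometry_comp {φ : SpaceForm ε m s → SpaceForm ε n p}
    (hφ : ContMDiff 𝓘(ℝ, Fin m → ℝ) 𝓘(ℝ, Fin n → ℝ) ∞ φ)
    {Ψ : SpaceForm ε n p → SpaceForm ε n p}
    (hΨ : ContMDiff 𝓘(ℝ, Fin n → ℝ) 𝓘(ℝ, Fin n → ℝ) ∞ Ψ)
    (hiso : IsIsometric (spaceFormMetric ε n p) (spaceFormMetric ε n p) Ψ) (x : SpaceForm ε m s)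
    (u v : TangentSpace 𝓘(ℝ, Fin m → ℝ) x) (ξ : TangentSpace 𝓘(ℝ, Fin n → ℝ) (φ x)) :
    secondFundamentalForm ε (Ψ ∘ φ) x u v
        (mfderiv 𝓘(ℝ, Fin n → ℝ) 𝓘(ℝ, Fin n → ℝ) Ψ (φ x) ξ) =
      secondFundamentalForm ε φ x u v ξ := by
  set c := chartAt (Fin m → ℝ) x
  set χ := chartAt (Fin n → ℝ) (φ x)
  -- In the chart `χ` the inclusion and its composition with `Ψ` are two isometric immersions `X`
  -- and `F`; the second derivatives compared are those of `X ∘ g` and `F ∘ g`.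
  let X := param ε n p (φ x)
  let F : (Fin n → ℝ) → Fin (ambDim ε n) → ℝ := incl ε n p ∘ Ψ ∘ χ.symm
  let g : (Fin m → ℝ) → Fin n → ℝ := χ ∘ φ ∘ c.symm
  have hsymm : ∀ y ∈ χ.target, ContMDiffAt 𝓘(ℝ, Fin n → ℝ) 𝓘(ℝ, Fin n → ℝ) ∞ χ.symm y :=
    fun y hy => contMDiffAt_chartAt_symm (φ x) hy
  have hgx : g (c x) = χ (φ x) := by
    simp only [g, Function.comp_apply]
    rw [c.left_inv (mem_chart_source _ x)]
  have hφc : ContMDiffAt 𝓘(ℝ, Fin m → ℝ) 𝓘(ℝ, Fin n → ℝ) ∞ (φ ∘ c.symm) (c x) :=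
    hφ.contMDiffAt.comp _ (contMDiffAt_chartAt_symm x (mem_chart_target _ x))
  have hφcx : (φ ∘ c.symm) (c x) = φ x := by
    rw [Function.comp_apply, c.left_inv (mem_chart_source _ x)]
  have hχ : ContMDiffAt 𝓘(ℝ, Fin n → ℝ) 𝓘(ℝ, Fin n → ℝ) ∞ χ (φ x) :=
    contMDiffOn_chart.contMDiffAt (χ.open_source.mem_nhds (mem_chart_source _ (φ x)))
  have hg : ContDiffAt ℝ ∞ g (c x) := by
    refine ContMDiffAt.contDiffAt (ContMDiffAt.comp (g := χ) (f := φ ∘ c.symm) (c x) ?_ hφc)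
    rw [hφcx]
    exact hχ
  have hF : ∀ y ∈ χ.target, ContDiffAt ℝ ∞ F y := fun y hy =>
    ((contMDiff_incl ε n p).contMDiffAt.comp y
      (hΨ.contMDiffAt.comp y (hsymm y hy))).contDiffAt
  have hFd : ∀ y ∈ χ.target, ∀ w, fderiv ℝ F y w = dIncl ε n p (Ψ (χ.symm y))
      (mfderiv 𝓘(ℝ, Fin n → ℝ) 𝓘(ℝ, Fin n → ℝ) Ψ (χ.symm y)
        (mfderiv 𝓘(ℝ, Fin n → ℝ) 𝓘(ℝ, Fin n → ℝ) χ.symm y w)) := by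
    intro y hy w
    have h1 : MDifferentiableAt 𝓘(ℝ, Fin n → ℝ) 𝓘(ℝ, Fin n → ℝ) Ψ (χ.symm y) :=
      hΨ.mdifferentiable (by simp) _
    have h2 := (hsymm y hy).mdifferentiableAt (by simp)
    rw [← mfderiv_eq_fderiv]
    refine (mfderiv_incl_comp (f := Ψ ∘ χ.symm) (h1.comp y h2) w).trans ?_
    rw [mfderiv_comp y h1 h2]
    rfl
  have htarget : χ (φ x) ∈ χ.target := mem_chart_target _ (φ x)
  have hmetric : ∀ᶠ y in 𝓝 (g (c x)), ∀ v w,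
      ambFormL ε n p (fderiv ℝ F y v) (fderiv ℝ F y w) =
        ambFormL ε n p (fderiv ℝ X y v) (fderiv ℝ X y w) := by
    rw [hgx]
    filter_upwards [χ.open_target.mem_nhds htarget] with y hy v w
    rw [hFd y hy, hFd y hy, fderiv_param _ hy, fderiv_param _ hy]
    exact hiso (χ.symm y) _ _
  have hXξ : fderiv ℝ X (g (c x)) ξ = dIncl ε n p (φ x) ξ := by
    rw [hgx, dIncl_eq_fderiv]
  have hFξ : fderiv ℝ F (g (c x)) ξ = dIncl ε n p (Ψ (φ x))
      (mfderiv 𝓘(ℝ, Fin n → ℝ) 𝓘(ℝ, Fin n → ℝ) Ψ (φ x) ξ) := by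
    have h1 : MDifferentiableAt 𝓘(ℝ, Fin n → ℝ) 𝓘(ℝ, Fin n → ℝ) Ψ (φ x) :=
      hΨ.mdifferentiable (by simp) _
    rw [hgx, ← mfderiv_incl_comp h1, mfderiv_eq_fderiv_chartAt
      (((contMDiff_incl ε n p).mdifferentiable (by simp) _).comp _ h1)]
    rfl
  -- Near `c x`, the composition `χ.symm ∘ χ` cancels.
  have hcancel : ∀ᶠ y in 𝓝 (c x), χ.symm (g y) = φ (c.symm y) := by
    have := hφc.continuousAt.eventually_mem
      (hφcx ▸ χ.open_source.mem_nhds (mem_chart_source _ (φ x)))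
    filter_upwards [this] with y hy
    exact χ.left_inv hy
  have hXg : X ∘ g =ᶠ[𝓝 (c x)] incl ε n p ∘ φ ∘ c.symm :=
    hcancel.mono fun y hy => congrArg (incl ε n p) hy
  have hFg : F ∘ g =ᶠ[𝓝 (c x)] incl ε n p ∘ (Ψ ∘ φ) ∘ c.symm :=
    hcancel.mono fun y hy => congrArg (incl ε n p ∘ Ψ) hy
  have key := bilin_fderiv_fderiv_comp_eq_of_isometric (ambFormL ε n p) (ambFormL_comm ε n p)
    (hF _ (hgx ▸ htarget)) (contDiffAt_param _ (hgx ▸ htarget)) hg hmetric u v ξ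
  rw [hXξ, hFξ, hXg.fderiv.fderiv_eq, hFg.fderiv.fderiv_eq] at key
  exact key

/-! ### Jointly smooth families are continuous in the compact-open smooth topology -/

section Family

variable {E : Type*} [NormedAddCommGroup E] [NormedSpace ℝ E]
  {M : Type*} [TopologicalSpace M] [ChartedSpace E M]
  {E' : Type*} [NormedAddCommGroup E'] [NormedSpace ℝ E']
  {M' : Type*} [TopologicalSpace M'] [ChartedSpace E' M']

lemma contDiffAt_localRepresentative {Φ : ℝ → M → M'}
    (hΦ : ContMDiff (𝓘(ℝ, ℝ).prod 𝓘(ℝ, E)) 𝓘(ℝ, E') ∞ fun z : ℝ × M => Φ z.1 z.2)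
    {φ : OpenPartialHomeomorph M E} {χ : OpenPartialHomeomorph M' E'}
    (hφ : φ ∈ IsManifold.maximalAtlas 𝓘(ℝ, E) ∞ M)
    (hχ : χ ∈ IsManifold.maximalAtlas 𝓘(ℝ, E') ∞ M') {a : ℝ} {x : M} (hx : x ∈ φ.source)
    (hax : Φ a x ∈ χ.source) :
    ContDiffAt ℝ ∞ (Function.uncurry fun a => χ ∘ Φ a ∘ φ.symm) (a, φ x) := by
  have h1 : ContMDiffAt 𝓘(ℝ, E) 𝓘(ℝ, E) ∞ φ.symm (φ x) :=
    (contMDiffOn_symm_of_mem_maximalAtlas hφ).contMDiffAt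
      (φ.open_target.mem_nhds (φ.map_source hx))
  have h2 : ContMDiffAt 𝓘(ℝ, ℝ × E) 𝓘(ℝ, E) ∞ (fun z : ℝ × E => φ.symm z.2) (a, φ x) :=
    ContMDiffAt.comp (a, φ x) (g := φ.symm) (f := Prod.snd) h1 contDiff_snd.contMDiff.contMDiffAt
  have h3 : ContMDiffAt 𝓘(ℝ, ℝ × E) (𝓘(ℝ, ℝ).prod 𝓘(ℝ, E)) ∞
      (fun z : ℝ × E => (z.1, φ.symm z.2)) (a, φ x) :=
    contDiff_fst.contMDiff.contMDiffAt.prodMk h2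
  have h4 : ContMDiffAt 𝓘(ℝ, ℝ × E) 𝓘(ℝ, E') ∞ (fun z : ℝ × E => Φ z.1 (φ.symm z.2)) (a, φ x) :=
    hΦ.contMDiffAt.comp _ h3
  have h5 : ContMDiffAt 𝓘(ℝ, E') 𝓘(ℝ, E') ∞ χ (Φ a (φ.symm (φ x))) := by
    rw [φ.left_inv hx]
    exact (contMDiffOn_of_mem_maximalAtlas hχ).contMDiffAt (χ.open_source.mem_nhds hax)
  exact (ContMDiffAt.comp (a, φ x) (g := χ) (f := fun z : ℝ × E => Φ z.1 (φ.symm z.2))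
    h5 h4).contDiffAt

lemma continuousAt_iteratedFDeriv_localRepresentative {Φ : ℝ → M → M'}
    (hΦ : ContMDiff (𝓘(ℝ, ℝ).prod 𝓘(ℝ, E)) 𝓘(ℝ, E') ∞ fun z : ℝ × M => Φ z.1 z.2)
    {φ : OpenPartialHomeomorph M E} {χ : OpenPartialHomeomorph M' E'}
    (hφ : φ ∈ IsManifold.maximalAtlas 𝓘(ℝ, E) ∞ M)
    (hχ : χ ∈ IsManifold.maximalAtlas 𝓘(ℝ, E') ∞ M') {a : ℝ} {x : M} (hx : x ∈ φ.source)
    (hax : Φ a x ∈ χ.source) (k : ℕ) :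
    ContinuousAt (fun z : ℝ × M => iteratedFDeriv ℝ k (χ ∘ Φ z.1 ∘ φ.symm) (φ z.2)) (a, x) := by
  have h := (contDiffAt_iteratedFDeriv_param
    (contDiffAt_localRepresentative hΦ hφ hχ hx hax) k).continuousAt
  have hc : ContinuousAt (fun z : ℝ × M => (z.1, φ z.2)) (a, x) :=
    continuousAt_fst.prodMk ((φ.continuousAt hx).comp continuousAt_snd)
  exact ContinuousAt.comp (x := (a, x)) h hc

lemma tendsto_of_contMDiff_family {Φ : ℝ → C^∞⟮𝓘(ℝ, E), M; 𝓘(ℝ, E'), M'⟯}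
    (hΦ : ContMDiff (𝓘(ℝ, ℝ).prod 𝓘(ℝ, E)) 𝓘(ℝ, E') ∞ fun z : ℝ × M => Φ z.1 z.2) (a₀ : ℝ) :
    Tendsto Φ (𝓝 a₀) (𝓝 (Φ a₀)) := by
  rw [TopologicalSpace.tendsto_nhds_generateFrom_iff]
  rintro _ ⟨f, φ, χ, K, r, δ, hφ, hχ, hK, hKφ, hfK, hδ, rfl⟩ ⟨h1, h2⟩
  have hf : ContMDiff (𝓘(ℝ, ℝ).prod 𝓘(ℝ, E)) 𝓘(ℝ, E') ∞ fun z : ℝ × M => f z.2 :=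
    f.contMDiff.comp contMDiff_snd
  have hmaps : ∀ᶠ a in 𝓝 a₀, ∀ x ∈ K, Φ a x ∈ χ.source :=
    hK.eventually_forall_of_forall_eventually fun x hx =>
      hΦ.continuous.continuousAt.eventually_mem (χ.open_source.mem_nhds (h1 hx))
  have hclose : ∀ k ∈ Set.Iic r, ∀ᶠ a in 𝓝 a₀, ∀ x ∈ K,
      ‖iteratedFDeriv ℝ k (χ ∘ Φ a ∘ φ.symm) (φ x)
        - iteratedFDeriv ℝ k (χ ∘ f ∘ φ.symm) (φ x)‖ < δ := by
    refine fun k hk => hK.eventually_forall_of_forall_eventually fun x hx => ?_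
    have c1 := continuousAt_iteratedFDeriv_localRepresentative (Φ := fun a x => Φ a x) hΦ hφ hχ
      (hKφ hx) (h1 hx) k
    have c2 := continuousAt_iteratedFDeriv_localRepresentative (Φ := fun _ => f) (a := a₀) hf hφ hχ
      (hKφ hx) (hfK hx) k
    exact (c1.sub c2).norm.eventually_lt continuousAt_const (h2 x hx k hk)
  filter_upwards [hmaps, (eventually_all_finite (Set.finite_Iic r)).2 hclose] with a ha1 ha2
  exact ⟨ha1, fun x hx k hk => ha2 k hk x hx⟩

end Family

/-! ### The ambient maps restricting to the family `ψ_a` -/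

/-- The border of `ψ_a(x)` as a function on the pseudo-Euclidean space. -/
def border (ε : SignType) (m s : ℕ) (a : ℝ) (y : Fin (ambDim ε m) → ℝ) : ℝ :=
  if ε = 0 then a * ambForm ε m s y y else a

/-- The map of pseudo-Euclidean spaces that restricts to `ψ_a`. -/
def ambPsi (ε : SignType) (m s n : ℕ) (a : ℝ) (y : Fin (ambDim ε m) → ℝ) :
    Fin (ambDim ε n) → ℝ :=
  bordered (ambIndex ε s) (ambDim ε n) (border ε m s a y) y

lemma contDiff_border : ContDiff ℝ ∞ fun z : ℝ × (Fin (ambDim ε m) → ℝ) =>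
    border ε m s z.1 z.2 := by
  unfold border
  split_ifs
  · exact contDiff_fst.mul ((contDiff_ambForm_self ε m s).comp contDiff_snd)
  · exact contDiff_fst

lemma contDiff_ambPsi : ContDiff ℝ ∞ fun z : ℝ × (Fin (ambDim ε m) → ℝ) =>
    ambPsi ε m s n z.1 z.2 :=
  (borderedCLM (ambIndex ε s) (ambDim ε m) (ambDim ε n)).contDiff.comp
    (contDiff_border.prodMk contDiff_snd)

lemma contDiff_border_right (a : ℝ) : ContDiff ℝ ∞ (border ε m s a) :=
  contDiff_border.comp (contDiff_prodMk_right a)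

lemma contDiff_ambPsi_right (a : ℝ) : ContDiff ℝ ∞ (ambPsi ε m s n a) :=
  contDiff_ambPsi.comp (contDiff_prodMk_right a)

lemma fderiv_ambPsi (a : ℝ) (y u : Fin (ambDim ε m) → ℝ) :
    fderiv ℝ (ambPsi ε m s n a) y u =
      bordered (ambIndex ε s) (ambDim ε n) (fderiv ℝ (border ε m s a) y u) u := by
  have h := ((contDiff_border_right (ε := ε) (m := m) (s := s) a).differentiable
    (by simp) y).hasFDerivAt
  have h2 := (borderedCLM (ambIndex ε s) (ambDim ε m) (ambDim ε n)).hasFDerivAt.comp y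
    (h.prodMk (hasFDerivAt_id y))
  exact DFunLike.congr_fun h2.fderiv u

lemma border_zero : border ε m s 0 = fun _ => 0 := by
  funext y
  simp [border]

lemma inv_mul_border {a : ℝ} (ha : a ≠ 0) (y : Fin (ambDim ε m) → ℝ) :
    a⁻¹ * border ε m s a y = border ε m s 1 y := by
  unfold border
  split_ifs <;> field_simp

/-- The inequalities between dimensions and indices under which a bordered vector keeps its scalar
products, for the ambient spaces of `𝕄^m_s(ε)` and `𝕄^n_p(ε)`. -/
lemma ambient_inequalities (ε : SignType) (hs : s ≤ m) (hn : m + 2 ≤ n) (hp : s + 1 ≤ p)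
    (hq : m + 1 + p ≤ n + s) :
    ambDim ε m + 2 ≤ ambDim ε n ∧ ambIndex ε s + 1 ≤ ambIndex ε p ∧
      ambDim ε m + 1 + ambIndex ε p ≤ ambDim ε n + ambIndex ε s ∧ ambIndex ε s ≤ ambDim ε m := by
  match ε with
  | 0 => simp only [ambDim, ambIndex]; omega
  | 1 => simp only [ambDim, ambIndex]; omega
  | -1 => simp only [ambDim, ambIndex]; omega

lemma exists_spaceForm (ε : SignType) (hs : s ≤ m) : Nonempty (SpaceForm ε m s) := by
  match ε with
  | 0 => exact ⟨(0 : Fin m → ℝ)⟩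
  | 1 =>
    refine ⟨⟨Pi.single (Fin.last m) 1, ?_⟩⟩
    rw [pseudoInner_single, eta, if_neg (by simpa using hs)]
    simp
  | -1 =>
    refine ⟨⟨Pi.single 0 1, ?_⟩⟩
    rw [pseudoInner_single, eta, if_pos (by simp)]
    simp

lemma secondFundamentalForm_psi (a : ℝ) {φ : SpaceForm ε m s → SpaceForm ε n p}
    (hφ : ∀ x, incl ε n p (φ x) = ambPsi ε m s n a (incl ε m s x)) (x : SpaceForm ε m s)
    (u v : TangentSpace 𝓘(ℝ, Fin m → ℝ) x) (ξ : TangentSpace 𝓘(ℝ, Fin n → ℝ) (φ x)) :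
    secondFundamentalForm ε φ x u v ξ = ambForm ε n p
      (bordered (ambIndex ε s) (ambDim ε n)
        (fderiv ℝ (fderiv ℝ (border ε m s a ∘ param ε m s x)) (chartAt (Fin m → ℝ) x x) u v)
        (fderiv ℝ (fderiv ℝ (param ε m s x)) (chartAt (Fin m → ℝ) x x) u v))
      (dIncl ε n p (φ x) ξ) := by
  have h : incl ε n p ∘ φ ∘ (chartAt (Fin m → ℝ) x).symm =
      borderedCLM (ambIndex ε s) (ambDim ε m) (ambDim ε n) ∘
        fun y => ((border ε m s a ∘ param ε m s x) y, param ε m s x y) := funext fun y => hφ _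
  have hX := contDiffAt_param_self x
  have hb : ContDiffAt ℝ ∞ (border ε m s a ∘ param ε m s x) (chartAt (Fin m → ℝ) x x) :=
    (contDiff_border_right a).contDiffAt.comp _ hX
  have h2 : ∀ u v : Fin m → ℝ, fderiv ℝ (fderiv ℝ (incl ε n p ∘ φ ∘
      (chartAt (Fin m → ℝ) x).symm)) (chartAt (Fin m → ℝ) x x) u v =
      bordered (ambIndex ε s) (ambDim ε n)
        (fderiv ℝ (fderiv ℝ (border ε m s a ∘ param ε m s x)) (chartAt (Fin m → ℝ) x x) u v)
        (fderiv ℝ (fderiv ℝ (param ε m s x)) (chartAt (Fin m → ℝ) x x) u v) := fun u v => by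
    rw [h, fderiv_fderiv_clm_comp _ (hb.prodMk hX), fderiv_fderiv_prodMk hb hX, borderedCLM_apply]
  exact congrArg (fun z => ambForm ε n p z (dIncl ε n p (φ x) ξ)) (h2 u v)

lemma dIncl_mfderiv_psi (a : ℝ) {φ : SpaceForm ε m s → SpaceForm ε n p}
    (hφs : ContMDiff 𝓘(ℝ, Fin m → ℝ) 𝓘(ℝ, Fin n → ℝ) ∞ φ)
    (hφ : ∀ x, incl ε n p (φ x) = ambPsi ε m s n a (incl ε m s x)) (x : SpaceForm ε m s)
    (w : TangentSpace 𝓘(ℝ, Fin m → ℝ) x) :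
    dIncl ε n p (φ x) (mfderiv 𝓘(ℝ, Fin m → ℝ) 𝓘(ℝ, Fin n → ℝ) φ x w) =
      bordered (ambIndex ε s) (ambDim ε n)
        (fderiv ℝ (border ε m s a) (incl ε m s x) (dIncl ε m s x w)) (dIncl ε m s x w) := by
  rw [dIncl_mfderiv (contDiff_ambPsi_right a) hφs hφ, fderiv_ambPsi]

/-- `ψ_0` is totally geodesic: its second derivatives lie in the sum of its tangent space and the
line of its position vector. -/
lemma isTotallyGeodesic_psi_zero {φ : SpaceForm ε m s → SpaceForm ε n p}
    (hφs : ContMDiff 𝓘(ℝ, Fin m → ℝ) 𝓘(ℝ, Fin n → ℝ) ∞ φ)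
    (hφ : ∀ x, incl ε n p (φ x) = ambPsi ε m s n 0 (incl ε m s x)) : IsTotallyGeodesic ε φ := by
  intro x u v ξ hξ
  have hξ' : ∀ w, ambForm ε n p
      (borderedCLM (ambIndex ε s) (ambDim ε m) (ambDim ε n) (0, dIncl ε m s x w))
      (dIncl ε n p (φ x) ξ) = 0 := by
    intro w
    have h := hξ w
    change ambForm ε n p (dIncl ε n p (φ x) _) (dIncl ε n p (φ x) ξ) = 0 at h
    rw [dIncl_mfderiv_psi 0 hφs hφ, border_zero, fderiv_fun_const] at h
    exact h
  rw [secondFundamentalForm_psi 0 hφ]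
  have hb : border ε m s 0 ∘ param ε m s x = fun _ => 0 := by rw [border_zero]; rfl
  have hb2 : fderiv ℝ (fderiv ℝ fun _ : Fin m → ℝ => (0 : ℝ)) = fun _ => 0 := by
    rw [fderiv_fun_const, Pi.zero_def, fderiv_fun_const]; rfl
  rw [hb, hb2]
  obtain ⟨w, t, h, ht⟩ := exists_dIncl_add x
    (fderiv ℝ (fderiv ℝ (param ε m s x)) (chartAt (Fin m → ℝ) x x) u v)
  rw [h]
  change ambForm ε n p (borderedCLM (ambIndex ε s) (ambDim ε m) (ambDim ε n)
    (0, dIncl ε m s x w + t • incl ε m s x)) _ = 0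
  have h2 : ((0 : ℝ), dIncl ε m s x w + t • incl ε m s x) =
      (0, dIncl ε m s x w) + t • (0, incl ε m s x) := by simp
  rw [h2, map_add, map_add, LinearMap.add_apply, hξ' w, zero_add, map_smul, map_smul,
    LinearMap.smul_apply]
  by_cases hε : ε = 0
  · rw [ht hε, zero_smul]
  · have h3 : incl ε n p (φ x) =
        borderedCLM (ambIndex ε s) (ambDim ε m) (ambDim ε n) (0, incl ε m s x) := by
      rw [hφ, ambPsi, border_zero]; rfl
    rw [← h3, ambForm_incl_dIncl hε, smul_zero]

section Psi

variable (hs : s ≤ m) (hn : m + 2 ≤ n) (hp : s + 1 ≤ p) (hq : m + 1 + p ≤ n + s)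

include hs hn hp hq

lemma ambForm_bordered (b c : ℝ) (x y : Fin (ambDim ε m) → ℝ) :
    ambForm ε n p (bordered (ambIndex ε s) (ambDim ε n) b x)
      (bordered (ambIndex ε s) (ambDim ε n) c y) = ambForm ε m s x y := by
  obtain ⟨h1, h2, h3, h4⟩ := ambient_inequalities ε hs hn hp hq
  exact pseudoInner_bordered_bordered h1 h2 h3 h4 b c x y

/-- The first basis vector is timelike, and its product with a bordered vector reads off the
border. -/
lemma exists_ambForm_bordered_eq_neg : ∃ e : Fin (ambDim ε n) → ℝ, ambForm ε n p e e = -1 ∧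
    ∀ b (x : Fin (ambDim ε m) → ℝ),
      ambForm ε n p e (bordered (ambIndex ε s) (ambDim ε n) b x) = -b := by
  obtain ⟨h1, h2, h3, h4⟩ := ambient_inequalities ε hs hn hp hq
  refine ⟨Pi.single ⟨0, by omega⟩ 1, ?_, pseudoInner_single_zero_bordered (by omega) h2⟩
  rw [pseudoInner_single, eta, if_pos (by simp only; omega)]
  simp

lemma exists_psi :
    ∃ ψ : ℝ → IsometricImmersion (spaceFormMetric ε m s) (spaceFormMetric ε n p),
      ∀ (a : ℝ) (x : SpaceForm ε m s),
        incl ε n p ((ψ a).1 x) = ambPsi ε m s n a (incl ε m s x) := by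
  choose f hf using fun a : ℝ => exists_contMDiffMap (p := p) (ambPsi ε m s n a)
    (contDiff_ambPsi_right a) fun y => ambForm_bordered hs hn hp hq _ _ y y
  refine ⟨fun a => ⟨f a, isIsometric_of_incl (contDiff_ambPsi_right a) ?_ (f a).contMDiff (hf a)⟩,
    hf⟩
  intro y u v
  rw [fderiv_ambPsi, fderiv_ambPsi, ambForm_bordered hs hn hp hq]

/-- The linear isometry that multiplies the border by `c`. -/
lemma exists_diffeomorph_bordered {c : ℝ} (hc : c ≠ 0) :
    ∃ Ψ : SpaceForm ε n p ≃ₘ⟮𝓘(ℝ, Fin n → ℝ), 𝓘(ℝ, Fin n → ℝ)⟯ SpaceForm ε n p,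
      IsIsometric (spaceFormMetric ε n p) (spaceFormMetric ε n p) Ψ ∧
      ∀ (x : SpaceForm ε n p) (b : ℝ) (y : Fin (ambDim ε m) → ℝ),
        incl ε n p x = bordered (ambIndex ε s) (ambDim ε n) b y →
        incl ε n p (Ψ x) = bordered (ambIndex ε s) (ambDim ε n) (c * b) y := by
  obtain ⟨e, hee, he⟩ := exists_ambForm_bordered_eq_neg (ε := ε) hs hn hp hq
  have hB : ∀ v w, ambForm ε n p v w = ambForm ε n p w v := pseudoInner_comm _ _
  have hbb := ambForm_bordered (ε := ε) hs hn hp hq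
  -- The null direction `k` of the border and a second null vector `l`, both orthogonal to the
  -- vectors with border `0`.
  let k : Fin (ambDim ε n) → ℝ := bordered (ambIndex ε s) (ambDim ε n) 1 (0 : Fin (ambDim ε m) → ℝ)
  let l : Fin (ambDim ε n) → ℝ := (2 : ℝ) • e - k
  have hkb : ∀ b y, ambForm ε n p k (bordered (ambIndex ε s) (ambDim ε n) b y) = 0 := fun b y => by
    rw [hbb]; simp
  have hk : ambForm ε n p k k = 0 := hkb _ _
  have hek : ambForm ε n p e k = -1 := he 1 0
  have hlb : ∀ b (y : Fin (ambDim ε m) → ℝ),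
      ambForm ε n p l (bordered (ambIndex ε s) (ambDim ε n) b y) = -2 * b := fun b y => by
    simp only [l, map_sub, map_smul, LinearMap.sub_apply, LinearMap.smul_apply, hkb, he,
      smul_eq_mul]
    ring
  have hkl : ambForm ε n p k l = -2 := by rw [hB, hlb]; ring
  have hl : ambForm ε n p l l = 0 := by
    have h : ambForm ε n p l e = -1 := by
      simp only [l, map_sub, map_smul, LinearMap.sub_apply, LinearMap.smul_apply, hB k e, hek, hee,
        smul_eq_mul]
      norm_num
    have h2 : ambForm ε n p l ((2 : ℝ) • e - k) = 0 := by
      rw [map_sub, map_smul, h, hB l k, hkl]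
      norm_num
    exact h2
  let L : ℝ → (Fin (ambDim ε n) → ℝ) →L[ℝ] (Fin (ambDim ε n) → ℝ) := fun c =>
    LinearMap.toContinuousLinearMap (boost (ambForm ε n p) k l c)
  have hL : ∀ {c : ℝ}, c ≠ 0 → ∀ v w, ambForm ε n p (L c v) (L c w) = ambForm ε n p v w :=
    fun hc => bilin_boost_boost hB hk hl hkl hc
  have hinv : ∀ {c : ℝ}, c ≠ 0 → ∀ v, L c (L c⁻¹ v) = v := fun hc =>
    boost_boost_inv hB hk hl hkl hc
  obtain ⟨f, hf⟩ := exists_contMDiffMap (s := p) (p := p) (L c) (L c).contDiff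
    fun y => hL hc y y
  obtain ⟨g, hg⟩ := exists_contMDiffMap (s := p) (p := p) (L c⁻¹) (L c⁻¹).contDiff
    fun y => hL (inv_ne_zero hc) y y
  refine ⟨⟨⟨f, g, fun x => incl_injective ε n p ?_, fun x => incl_injective ε n p ?_⟩,
    f.contMDiff, g.contMDiff⟩, isIsometric_of_incl (L c).contDiff ?_ f.contMDiff hf, ?_⟩
  · rw [hg, hf]
    simpa using hinv (inv_ne_zero hc) (incl ε n p x)
  · rw [hf, hg, hinv hc]
  · intro y u v
    rw [ContinuousLinearMap.fderiv, hL hc]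
  · intro x b y hx
    refine (hf x).trans ?_
    rw [hx]
    change boost (ambForm ε n p) k l c _ = _
    rw [boost_apply, hlb, hkb, mul_zero, zero_smul, add_zero]
    have h1 := (borderedCLM (ambIndex ε s) (ambDim ε m) (ambDim ε n)).map_add (b, y)
      (((1 - c) / 2 * (-2 * b)) • (1, 0))
    rw [map_smul] at h1
    refine h1.symm.trans ?_
    rw [borderedCLM_apply]
    congr 1
    · simp only [Prod.smul_mk, Prod.mk_add_mk, smul_eq_mul]
      ring
    · simp

/-- `ψ_1` is not totally geodesic: its second fundamental form is a nonzero multiple of the metric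
times the null vector `(1, 0, …, 0, 1)`. -/
lemma not_isTotallyGeodesic_psi_one (hm : 1 ≤ m) {φ : SpaceForm ε m s → SpaceForm ε n p}
    (hφs : ContMDiff 𝓘(ℝ, Fin m → ℝ) 𝓘(ℝ, Fin n → ℝ) ∞ φ)
    (hφ : ∀ x, incl ε n p (φ x) = ambPsi ε m s n 1 (incl ε m s x)) :
    ¬ IsTotallyGeodesic ε φ := by
  intro hφg
  obtain ⟨e, -, he⟩ := exists_ambForm_bordered_eq_neg (ε := ε) hs hn hp hq
  have he' : ∀ b (x : Fin (ambDim ε m) → ℝ),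
      ambForm ε n p (bordered (ambIndex ε s) (ambDim ε n) b x) e = -b := fun b x =>
    (pseudoInner_comm _ _ _ _).trans (he b x)
  have hbb := ambForm_bordered (ε := ε) hs hn hp hq
  -- It suffices to find a point and a normal vector `η` there that detects the second derivatives.
  suffices h : ∃ (x : SpaceForm ε m s) (η : Fin (ambDim ε n) → ℝ),
      (ε ≠ 0 → ambForm ε n p (incl ε n p (φ x)) η = 0) ∧
      (∀ w, ambForm ε n p (bordered (ambIndex ε s) (ambDim ε n)
        (fderiv ℝ (border ε m s 1) (incl ε m s x) (dIncl ε m s x w)) (dIncl ε m s x w)) η = 0) ∧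
      ∀ u v : Fin m → ℝ, ambForm ε n p (bordered (ambIndex ε s) (ambDim ε n)
        (fderiv ℝ (fderiv ℝ (border ε m s 1 ∘ param ε m s x)) (chartAt (Fin m → ℝ) x x) u v)
        (fderiv ℝ (fderiv ℝ (param ε m s x)) (chartAt (Fin m → ℝ) x x) u v)) η = 0 →
        ambForm ε m s (fderiv ℝ (param ε m s x) (chartAt (Fin m → ℝ) x x) u)
          (fderiv ℝ (param ε m s x) (chartAt (Fin m → ℝ) x x) v) = 0 by
    obtain ⟨x, η, h1, h2, h3⟩ := h
    obtain ⟨ξ, hξ⟩ := exists_dIncl_eq (φ x) h1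
    obtain ⟨u, v, huv⟩ := exists_ambForm_dIncl_ne_zero hm x
    rw [dIncl_eq_fderiv, dIncl_eq_fderiv] at huv
    refine huv (h3 u v ?_)
    have h4 := hφg x u v ξ fun w => by
      change ambForm ε n p (dIncl ε n p (φ x) _) (dIncl ε n p (φ x) ξ) = 0
      rw [dIncl_mfderiv_psi 1 hφs hφ, hξ]
      exact h2 w
    rw [secondFundamentalForm_psi 1 hφ, hξ] at h4
    exact h4
  by_cases hε : ε = 0
  · subst hε
    obtain ⟨x, hx⟩ := exists_incl_eq (ε := 0) (n := m) (p := s) 0 fun h => absurd rfl h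
    have hborder : border 0 m s 1 = fun y => ambFormL 0 m s y y := by
      funext y
      simp [border, ambFormL_apply]
    refine ⟨x, e, fun h => absurd rfl h, fun w => ?_, fun u v h => ?_⟩
    · rw [he', hborder, fderiv_bilin_apply _ differentiableAt_fun_id differentiableAt_fun_id, hx]
      simp
    · have h1 : border 0 m s 1 ∘ param 0 m s x =
          fun y => ambFormL 0 m s (param 0 m s x y) (param 0 m s x y) := by rw [hborder]; rfl
      rw [he', h1, fderiv_fderiv_bilin_self _ (ambFormL_comm 0 m s) (contDiffAt_param_self x),
        param_chartAt, hx, map_zero, zero_apply, zero_add, neg_eq_zero] at h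
      exact (mul_eq_zero.1 h).resolve_left two_ne_zero
  · obtain ⟨x⟩ := exists_spaceForm ε hs
    have hborder : border ε m s 1 = fun _ => 1 := by
      funext y
      simp [border, hε]
    -- The position vector of `ψ_1(x)` is `(1, x, 0, 1)`, to which `(ε, x, 0, 0)` is orthogonal.
    refine ⟨x, bordered (ambIndex ε s) (ambDim ε n) 0 (incl ε m s x) + (ε : ℝ) • e,
      fun _ => ?_, fun w => ?_, fun u v h => ?_⟩
    · rw [hφ, ambPsi, hborder, map_add, map_smul, hbb, he', ambForm_incl_self hε, smul_eq_mul]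
      ring
    · rw [hborder, fderiv_fun_const, map_add, map_smul, hbb, he', pseudoInner_comm,
        ambForm_incl_dIncl hε]
      simp
    · have h1 : border ε m s 1 ∘ param ε m s x = fun _ => 1 := by rw [hborder]; rfl
      have h2 : fderiv ℝ (fderiv ℝ fun _ : Fin m → ℝ => (1 : ℝ)) = fun _ => 0 := by
        rw [fderiv_fun_const, Pi.zero_def, fderiv_fun_const]; rfl
      rw [h1, h2, map_add, map_smul, hbb, he', pseudoInner_comm,
        ambForm_param_fderiv_fderiv hε] at h
      simpa using h

end Psi

/-- Total geodesy is invariant under isometries of the target. -/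
lemma IsTotallyGeodesic.isometry_comp {φ : SpaceForm ε m s → SpaceForm ε n p}
    (h : IsTotallyGeodesic ε φ)
    (hφ : ContMDiff 𝓘(ℝ, Fin m → ℝ) 𝓘(ℝ, Fin n → ℝ) ∞ φ)
    (Ψ : SpaceForm ε n p ≃ₘ⟮𝓘(ℝ, Fin n → ℝ), 𝓘(ℝ, Fin n → ℝ)⟯ SpaceForm ε n p)
    (hΨ : IsIsometric (spaceFormMetric ε n p) (spaceFormMetric ε n p) Ψ) :
    IsTotallyGeodesic ε (Ψ ∘ φ) := by
  intro x u v ξ hξ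
  obtain ⟨ζ, rfl⟩ : ∃ ζ, mfderiv 𝓘(ℝ, Fin n → ℝ) 𝓘(ℝ, Fin n → ℝ) Ψ (φ x) ζ = ξ :=
    (Ψ.mfderivToContinuousLinearEquiv (by simp) (φ x)).surjective ξ
  rw [secondFundamentalForm_isometry_comp hφ Ψ.contMDiff hΨ]
  refine h x u v ζ fun w => ?_
  have h1 := hξ w
  rw [mfderiv_comp x (Ψ.mdifferentiable (by simp) _) (hφ.mdifferentiable (by simp) x)] at h1
  exact (hΨ (φ x) _ _).symm.trans h1

end SpaceFormModuli

end

/-! ### The family `ψ_a` and the moduli space -/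

open SpaceFormModuli in
theorem mainTheorem4 (ε : SignType) (m s n p : ℕ) (hm : 1 ≤ m) (hs : s ≤ m)
    (hn : m + 2 ≤ n) (hp : s + 1 ≤ p) (hq : m + 1 + p ≤ n + s) :
    ¬ T2Space (ModuliSpace (spaceFormMetric ε m s) (spaceFormMetric ε n p)) ∧
    ∃ ψ : ℝ → IsometricImmersion (spaceFormMetric ε m s) (spaceFormMetric ε n p),
      (∀ (a : ℝ) (x : SpaceForm ε m s), incl ε n p ((ψ a).1 x) =
        bordered (ambIndex ε s) (ambDim ε n) (psiEnd ε m s a x) (incl ε m s x)) ∧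
      (∀ a : ℝ, a ≠ 0 → Congruent (ψ a) (ψ 1)) ∧
      Filter.Tendsto ψ (nhds 0) (nhds (ψ 0)) ∧
      IsTotallyGeodesic ε (ψ 0).1 ∧
      ¬ Congruent (ψ 0) (ψ 1) := by
  obtain ⟨ψ, hψ⟩ := exists_psi (ε := ε) hs hn hp hq
  have hcongr : ∀ a : ℝ, a ≠ 0 → Congruent (ψ a) (ψ 1) := by
    intro a ha
    obtain ⟨Ψ, hΨ, h⟩ := exists_diffeomorph_bordered (ε := ε) hs hn hp hq (inv_ne_zero ha)
    refine ⟨Ψ, hΨ, fun x => incl_injective ε n p ?_⟩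
    rw [h _ _ _ (hψ a x), hψ, inv_mul_border ha]
    rfl
  have htendsto : Filter.Tendsto ψ (nhds 0) (nhds (ψ 0)) := by
    refine tendsto_subtype_rng.2 (tendsto_of_contMDiff_family (Φ := fun a => (ψ a).1) ?_ 0)
    refine contMDiff_of_incl ?_
    have h : (incl ε n p ∘ fun z : ℝ × SpaceForm ε m s => (ψ z.1).1 z.2) =
        (fun z : ℝ × (Fin (ambDim ε m) → ℝ) => ambPsi ε m s n z.1 z.2) ∘
          fun z : ℝ × SpaceForm ε m s => (z.1, incl ε m s z.2) := funext fun z => hψ z.1 z.2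
    rw [h]
    exact contDiff_ambPsi.contMDiff.comp
      (contMDiff_fst.prodMk_space ((contMDiff_incl ε m s).comp contMDiff_snd))
  have hgeod := isTotallyGeodesic_psi_zero (ψ 0).1.contMDiff (hψ 0)
  have hnot : ¬ Congruent (ψ 0) (ψ 1) := by
    rintro ⟨Ψ, hΨ, h⟩
    refine not_isTotallyGeodesic_psi_one hs hn hp hq hm (ψ 1).1.contMDiff (hψ 1) ?_
    have h1 : ⇑(ψ 1).1 = Ψ ∘ (ψ 0).1 := funext h
    rw [h1]
    exact hgeod.isometry_comp (ψ 0).1.contMDiff Ψ hΨ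
  refine ⟨fun hT2 => hnot ?_, ψ, hψ, hcongr, htendsto, hgeod, hnot⟩
  -- The class of `ψ_a`, `a ≠ 0`, is constant, so its limit in a Hausdorff quotient is unique.
  let q : IsometricImmersion (spaceFormMetric ε m s) (spaceFormMetric ε n p) →
    ModuliSpace (spaceFormMetric ε m s) (spaceFormMetric ε n p) := Quotient.mk _
  have h1 : Filter.Tendsto (q ∘ ψ) (nhdsWithin 0 {0}ᶜ) (nhds (q (ψ 0))) :=
    (continuous_quotient_mk'.tendsto (ψ 0)).comp (htendsto.mono_left nhdsWithin_le_nhds)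
  have h2 : Filter.Tendsto (q ∘ ψ) (nhdsWithin 0 {0}ᶜ) (nhds (q (ψ 1))) :=
    tendsto_const_nhds.congr' (eventually_mem_nhdsWithin.mono fun a ha =>
      (Quotient.sound (hcongr a ha)).symm)
  exact Quotient.exact (tendsto_nhds_unique h1 h2)
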